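/- Let $L,T>0$, let $a\in C^1([0,L];\mathbb R)$ and $b\in L^\infty((0,L);\mathbb R)$. For $\varepsilon>0$, $y_0\in L^2(0,L)$ and $h\in L^2(0,T)$ consider the controlled problem $$\partial_t y+a\,\partial_x y+b\,y-\varepsilon\,\partial_x^2y=0\ \text{ in }(0,T)\times(0,L),\qquad y(t,0)=h(t),\quad y(t,L)=0,\qquad y(0,x)=y_0(x).$$ Its solution $y\in C^0([0,T];L^2(0,L))$ is understood in the sense of transposition: for every $\tau\in[0,T]$ and every $\varphi$ on $[0,\tau]\times[0,L]$ such that $\varphi,\partial_t\varphi,\partial_x\varphi,\partial_x^2\varphi$ are continuous on $[0,\tau]\times[0,L]$ and $\varphi(t,0)=\varphi(t,L)=0$ for all $t\in[0,\tau]$, $$-\int_0^\tau\!\!\int_0^L y\,\bigl(\partial_t\varphi+a\,\partial_x\varphi+(a'-b)\varphi+\varepsilon\,\partial_x^2\varphi\bigr)\,dx\,dt-\varepsilon\int_0^\tau h(t)\,\partial_x\varphi(t,0)\,dt+\int_0^L y(\tau,x)\varphi(\tau,x)\,dx-\int_0^L y_0(x)\varphi(0,x)\,dx=0 .$$ Let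 $U(y_0)$ be the set of those $h\in L^2(0,T)$ for which the solution satisfies $y(T)=0$, and define the control cost $$\mathcal C_0(T,\varepsilon)=\sup_{y_0\in L^2(0,L),\ \|y_0\|_{L^2(0,L)}\le 1}\ \inf_{h\in U(y_0)}\|h\|_{L^2(0,T)}\in[0,+\infty],$$ where $\inf\emptyset=+\infty$. Set $T_a=\int_0^L\frac{ds}{|a(s)|}\in(0,+\infty]$, with the convention $1/0=+\infty$. Then $$T<T_a\quad\Longrightarrow\quad\liminf_{\varepsilon\to0^+}\mathcal C_0(T,\varepsilon)=+\infty .$$ -/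

import Mathlib

open MeasureTheory Set Filter Topology
open scoped ENNReal

noncomputable section

namespace ViscousTransport

/-- The real Hilbert space `L²(0,ℓ)` (Lebesgue measure). -/
abbrev L2 (ℓ : ℝ) : Type := Lp ℝ 2 (volume.restrict (Ioo (0 : ℝ) ℓ))

/-- `φ` is a test function on `[0,τ] × [0,L]`: `φ = φ(t,x)` is of class `C¹` in time and `C²` in
space up to the boundary, with `φt = ∂ₜφ`, `φx = ∂ₓφ`, `φxx = ∂ₓ²φ`, and it vanishes at the two
end points `x = 0` and `x = L`. -/
structure IsTestFunction (L τ : ℝ) (φ φt φx φxx : ℝ → ℝ → ℝ) : Prop where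
  cont : ContinuousOn (Function.uncurry φ) (Icc 0 τ ×ˢ Icc 0 L)
  cont_t : ContinuousOn (Function.uncurry φt) (Icc 0 τ ×ˢ Icc 0 L)
  cont_x : ContinuousOn (Function.uncurry φx) (Icc 0 τ ×ˢ Icc 0 L)
  cont_xx : ContinuousOn (Function.uncurry φxx) (Icc 0 τ ×ˢ Icc 0 L)
  deriv_t : ∀ t ∈ Icc 0 τ, ∀ x ∈ Icc 0 L,
    HasDerivWithinAt (fun s => φ s x) (φt t x) (Icc 0 τ) t
  deriv_x : ∀ t ∈ Icc 0 τ, ∀ x ∈ Icc 0 L,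
    HasDerivWithinAt (fun z => φ t z) (φx t x) (Icc 0 L) x
  deriv_xx : ∀ t ∈ Icc 0 τ, ∀ x ∈ Icc 0 L,
    HasDerivWithinAt (fun z => φx t z) (φxx t x) (Icc 0 L) x
  zero_left : ∀ t ∈ Icc 0 τ, φ t 0 = 0
  zero_right : ∀ t ∈ Icc 0 τ, φ t L = 0

/-- The formal adjoint expression `∂ₜφ + a ∂ₓφ + (a' - b) φ + ε ∂ₓ²φ` at `(t,x)`. -/
def adjointExpr (a b : ℝ → ℝ) (L ε : ℝ) (φ φt φx φxx : ℝ → ℝ → ℝ) (t x : ℝ) : ℝ :=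
  φt t x + a x * φx t x + (derivWithin a (Icc 0 L) x - b x) * φ t x + ε * φxx t x

/-- `y ∈ C⁰([0,T]; L²(0,L))` is a solution, in the sense of transposition, of
`(∂ₜ + a ∂ₓ + b - ε ∂ₓ²) y = 0` on `(0,T) × (0,L)`, with `y(t,0) = h(t)`, `y(t,L) = 0` and
`y(0,·) = y₀`. -/
structure IsSolution (a b : ℝ → ℝ) (L T ε : ℝ) (y₀ : L2 L) (h : L2 T) (y : ℝ → L2 L) :
    Prop where
  cont : ContinuousOn y (Icc 0 T)
  transposition : ∀ τ ∈ Icc 0 T, ∀ φ φt φx φxx : ℝ → ℝ → ℝ,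
    IsTestFunction L τ φ φt φx φxx →
      - (∫ t in Ioo 0 τ, ∫ x in Ioo 0 L, y t x * adjointExpr a b L ε φ φt φx φxx t x)
      - ε * (∫ t in Ioo 0 τ, h t * φx t 0)
      + (∫ x in Ioo 0 L, y τ x * φ τ x) - (∫ x in Ioo 0 L, y₀ x * φ 0 x) = 0

/-- The set `U(y₀)` of controls `h ∈ L²(0,T)` that steer `y₀` to `0` in time `T`. -/
def nullControls (a b : ℝ → ℝ) (L T ε : ℝ) (y₀ : L2 L) : Set (L2 T) :=
  {h | ∃ y : ℝ → L2 L, IsSolution a b L T ε y₀ h y ∧ y T = 0}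

/-- The control cost
`𝓒₀(T,ε) = sup { inf { ‖h‖ : h ∈ U(y₀) } : ‖y₀‖ ≤ 1 } ∈ [0,+∞]`, with `inf ∅ = +∞`. -/
def controlCost (a b : ℝ → ℝ) (L T ε : ℝ) : ℝ≥0∞ :=
  ⨆ (y₀ : L2 L) (_ : ‖y₀‖ ≤ 1), ⨅ h ∈ nullControls a b L T ε y₀, ENNReal.ofReal ‖h‖

/-- `T_a = ∫₀ᴸ ds / |a(s)| ∈ [0,+∞]`, with `1 / 0 = +∞`. -/
def transportTime (a : ℝ → ℝ) (L : ℝ) : ℝ≥0∞ :=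
  ∫⁻ s in Ioo 0 L, (ENNReal.ofReal |a s|)⁻¹

end ViscousTransport

end

/-! As ε → 0 the equation becomes a transport equation, and when T < T_a some initial data travel
along `a` without reaching the boundary up to time T. A bounded control cannot destroy such data if
the viscosity is small.

Geometry. If `a` is not identically zero, a segment [p, q] inside (0, L) contains no zero of `a` and
has travel time larger than T (`eq_zero_or_exists_long_interval`): next to an interior zero a C¹
function vanishes at least linearly, so 1/|a| has infinite integral there, and otherwise (0, L) is
exhausted by compact segments. Hence there is a cutoff χ with χ_t + a χ_x = 0, supported in [p, q]
during [0, T]; if `a` vanishes, any fixed bump does. This is `exists_cutoff`, which also gives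
functions ψ, bounded below at t = 0, that almost solve ψ_t + a ψ_x + (a' - b) ψ = 0 on the support
of χ. They solve it only up to a small L² error, because `b` is merely bounded and has to be
mollified to make ψ a legitimate test function.

Duality. Take y₀ = χ(0)/‖χ(0)‖ and test a null-controlled solution with φ = χψ. The final term
vanishes, and so does the control term, since χ is zero near x = 0. What remains says that ∫ y₀ χ(0)
ψ(0), which is at least c₀‖χ(0)‖, equals minus the double integral of χ y times the residual of ψ
plus ε y φ_xx.

Estimates. The first contribution is small if ‖χ y‖ is bounded uniformly in ε
(`exists_local_bound`); the second is O(√ε) because ε ∫‖y‖² is bounded (`exists_global_bound`). Both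
constants multiply ‖y₀‖² + ‖h‖². So if ‖h‖ < R, choosing ψ first and ε afterwards gives a
contradiction (`IsTransportedCutoff.eventually_le_norm`).

Since y is only a transposition solution, energy estimates are made on its sine coefficients, or
those of χ y (`galerkin_energy`). The transport term involves the full function rather than its
truncation, and the discrepancy costs a factor 1/ε. For χ y the discrepancy tends to zero with N at
fixed ε; for y itself it also contains the heat flow of the control, whence the weaker global bound.
-/

noncomputable section

namespace ViscousTransport

/-! ### Scalar ODE tools: relaxation equation and Grönwall -/

/-- The square of a primitive is twice the primitive of the product. -/
lemma sq_integral_eq {f : ℝ → ℝ} {T : ℝ} (hf : IntervalIntegrable f volume 0 T) :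
    (∫ t in (0:ℝ)..T, f t) ^ 2 = 2 * ∫ t in (0:ℝ)..T, (∫ s in (0:ℝ)..t, f s) * f t := by
  have hac := hf.absolutelyContinuousOnInterval_intervalIntegral (c := 0) left_mem_uIcc
  have h1 := hac.integral_deriv_mul_eq_sub hac
  have hae : ∀ᵐ t, t ∈ uIoc 0 T → deriv (fun t => ∫ s in (0:ℝ)..t, f s) t = f t := by
    filter_upwards [hf.ae_hasDerivAt_integral] with t ht hmem
    exact (ht (uIoc_subset_uIcc hmem) 0 left_mem_uIcc).deriv
  rw [intervalIntegral.integral_congr_ae (g := fun t => 2 * ((∫ s in (0:ℝ)..t, f s) * f t))] at h1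
  · rw [intervalIntegral.integral_const_mul] at h1
    rw [h1, intervalIntegral.integral_same]; ring
  · filter_upwards [hae] with t ht hmem
    rw [ht hmem]; ring

/-- The solution of `u' = h - l u`, `u(0) = 0`, for square integrable `h`, with its `L²` bound. -/
lemma exists_relaxation {h : ℝ → ℝ} {l T : ℝ} (hl : 0 < l) (hT : 0 ≤ T)
    (hi : IntervalIntegrable h volume 0 T)
    (hi2 : IntervalIntegrable (fun t => h t ^ 2) volume 0 T) :
    ∃ u : ℝ → ℝ, Continuous u ∧
      (∀ τ ∈ Icc 0 T, u τ = ∫ t in (0:ℝ)..τ, (h t - l * u t)) ∧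
      l ^ 2 * ∫ t in (0:ℝ)..T, u t ^ 2 ≤ ∫ t in (0:ℝ)..T, h t ^ 2 := by
  -- work with an extension of `h` by zero
  set g : ℝ → ℝ := (Ioc 0 T).indicator h with hg
  have hgi : Integrable g := by
    rw [hg, integrable_indicator_iff measurableSet_Ioc]
    exact (intervalIntegrable_iff_integrableOn_Ioc_of_le hT).1 hi
  have hgh : ∀ t ∈ Ioc 0 T, g t = h t := fun t ht => indicator_of_mem ht h
  set H : ℝ → ℝ := fun τ => ∫ t in (0:ℝ)..τ, g t with hH
  have hHc : Continuous H := intervalIntegral.continuous_primitive (fun a b => hgi.intervalIntegrable) 0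
  have hcE : Continuous fun s => Real.exp (l * s) * H s := by fun_prop
  -- `h` is only square integrable, so Duhamel's formula is applied to its primitive `H`: `W` solves
  -- W' = H - l W, and u = W' is the wanted solution, continuous by construction.
  set W : ℝ → ℝ := fun τ => Real.exp (-(l * τ)) * ∫ s in (0:ℝ)..τ, Real.exp (l * s) * H s with hW
  have hWd : ∀ τ, HasDerivAt W (H τ - l * W τ) τ := by
    intro τ
    have h1 : HasDerivAt (fun τ => ∫ s in (0:ℝ)..τ, Real.exp (l * s) * H s)
        (Real.exp (l * τ) * H τ) τ :=
      intervalIntegral.integral_hasDerivAt_right (hcE.intervalIntegrable _ _)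
        (hcE.stronglyMeasurableAtFilter _ _) hcE.continuousAt
    have h2 : HasDerivAt (fun τ => Real.exp (-(l * τ))) (Real.exp (-(l * τ)) * (-(l * 1))) τ :=
      (((hasDerivAt_id τ).const_mul l).neg).exp
    have h3 := h2.mul h1
    have he : Real.exp (-(l * τ)) * Real.exp (l * τ) = 1 := by rw [← Real.exp_add]; simp
    refine h3.congr_deriv ?_
    simp only [hW]
    linear_combination (H τ) * he
  have hWc : Continuous W := continuous_iff_continuousAt.2 fun τ => (hWd τ).continuousAt
  set u : ℝ → ℝ := fun τ => H τ - l * W τ with hu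
  have huc : Continuous u := by fun_prop
  have hintu : ∀ τ, ∫ t in (0:ℝ)..τ, u t = W τ := by
    intro τ
    have := intervalIntegral.integral_eq_sub_of_hasDerivAt (a := 0) (b := τ) (f := W) (f' := u)
      (fun t _ => hWd t) (huc.intervalIntegrable _ _)
    rw [this]; simp [hW]
  have hueq : ∀ τ, u τ = ∫ t in (0:ℝ)..τ, (g t - l * u t) := by
    intro τ
    rw [intervalIntegral.integral_sub hgi.intervalIntegrable ((huc.intervalIntegrable _ _).const_mul _),
      intervalIntegral.integral_const_mul, hintu]
  have hfi : IntervalIntegrable (fun t => g t - l * u t) volume 0 T :=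
    hgi.intervalIntegrable.sub ((huc.intervalIntegrable _ _).const_mul _)
  have hsq := sq_integral_eq hfi
  have hcongr : ∀ τ ∈ Icc 0 T, ∫ t in (0:ℝ)..τ, (g t - l * u t) = ∫ t in (0:ℝ)..τ, (h t - l * u t) := by
    intro τ hτ
    refine intervalIntegral.integral_congr_ae (Eventually.of_forall fun t ht => ?_)
    rw [uIoc_of_le hτ.1] at ht
    simp only [hgh t ⟨ht.1, ht.2.trans hτ.2⟩]
  refine ⟨u, huc, fun τ hτ => ?_, ?_⟩
  · rw [hueq, hcongr τ hτ]
  · have h1 : (0:ℝ) ≤ 2 * ∫ t in (0:ℝ)..T, u t * (h t - l * u t) := by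
      have : ∫ t in (0:ℝ)..T, (∫ s in (0:ℝ)..t, (g s - l * u s)) * (g t - l * u t) =
          ∫ t in (0:ℝ)..T, u t * (h t - l * u t) := by
        refine intervalIntegral.integral_congr_ae (Eventually.of_forall fun t ht => ?_)
        rw [uIoc_of_le hT] at ht
        simp only [hgh t ht, ← hueq]
      rw [← this, ← hsq]; positivity
    have hiu2 : IntervalIntegrable (fun t => u t ^ 2) volume 0 T :=
      (huc.pow 2).intervalIntegrable _ _
    have huh : IntervalIntegrable (fun t => u t * (h t - l * u t)) volume 0 T := by
      refine IntervalIntegrable.continuousOn_mul ?_ huc.continuousOn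
      exact hi.sub ((huc.intervalIntegrable _ _).const_mul _)
    -- The integrands differ by (h - l u)². The left side is nonnegative because 2∫u(h - l u) =
    -- u(T)².
    have h2 : ∫ t in (0:ℝ)..T, 2 * l * (u t * (h t - l * u t)) ≤
        ∫ t in (0:ℝ)..T, (h t ^ 2 - l ^ 2 * u t ^ 2) := by
      refine intervalIntegral.integral_mono_on hT (huh.const_mul _) (hi2.sub (hiu2.const_mul _)) ?_
      intro t _
      nlinarith [sq_nonneg (h t - l * u t)]
    rw [intervalIntegral.integral_const_mul, intervalIntegral.integral_sub hi2 (hiu2.const_mul _),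
      intervalIntegral.integral_const_mul] at h2
    nlinarith

/-- A Grönwall inequality for `f' ≤ K f + ρ`. -/
lemma gronwall_bound {f f' ρ : ℝ → ℝ} {K T : ℝ} (hK : 0 ≤ K)
    (hf : Continuous f) (hρ : Continuous ρ) (hρ0 : ∀ t, 0 ≤ ρ t)
    (hd : ∀ t ∈ Ioo 0 T, HasDerivAt f (f' t) t) (hle : ∀ t ∈ Ioo 0 T, f' t ≤ K * f t + ρ t)
    (hf0 : 0 ≤ f 0) :
    ∀ t ∈ Icc 0 T, f t ≤ Real.exp (K * T) * (f 0 + ∫ s in (0:ℝ)..T, ρ s) := by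
  intro τ hτ
  have hRd : ∀ t, HasDerivAt (fun t => ∫ s in (0:ℝ)..t, ρ s) (ρ t) t := fun t =>
    intervalIntegral.integral_hasDerivAt_right (hρ.intervalIntegrable _ _)
      (hρ.stronglyMeasurableAtFilter _ _) hρ.continuousAt
  have hRc : Continuous fun t => ∫ s in (0:ℝ)..t, ρ s :=
    continuous_iff_continuousAt.2 fun t => (hRd t).continuousAt
  set G : ℝ → ℝ := fun t => Real.exp (-(K * t)) * f t - ∫ s in (0:ℝ)..t, ρ s with hG
  have hGd : ∀ t ∈ Ioo 0 T,
      HasDerivAt G (Real.exp (-(K * t)) * (-(K * 1)) * f t + Real.exp (-(K * t)) * f' t - ρ t) t :=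
    fun t ht => (((((hasDerivAt_id t).const_mul K).neg).exp).mul (hd t ht)).sub (hRd t)
  have hanti : AntitoneOn G (Icc 0 T) := by
    refine antitoneOn_of_deriv_nonpos (convex_Icc 0 T) (by fun_prop) ?_ ?_
    · rw [interior_Icc]
      exact fun t ht => (hGd t ht).differentiableAt.differentiableWithinAt
    · rw [interior_Icc]
      intro t ht
      rw [(hGd t ht).deriv]
      have he : Real.exp (-(K * t)) ≤ 1 := Real.exp_le_one_iff.2 (by nlinarith [ht.1])
      have hp := Real.exp_pos (-(K * t))
      nlinarith [hle t ht, hρ0 t, mul_le_mul_of_nonneg_left (hle t ht) hp.le,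
        mul_nonneg (sub_nonneg.2 he) (hρ0 t)]
  have h1 := hanti (left_mem_Icc.2 (hτ.1.trans hτ.2)) hτ hτ.1
  simp only [hG, mul_zero, neg_zero, Real.exp_zero, one_mul, intervalIntegral.integral_same,
    sub_zero] at h1
  have hmono : ∫ s in (0:ℝ)..τ, ρ s ≤ ∫ s in (0:ℝ)..T, ρ s := by
    refine intervalIntegral.integral_mono_interval le_rfl hτ.1 hτ.2
      (Eventually.of_forall hρ0) (hρ.intervalIntegrable _ _)
  have hpos : 0 ≤ f 0 + ∫ s in (0:ℝ)..T, ρ s :=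
    add_nonneg hf0 (intervalIntegral.integral_nonneg (hτ.1.trans hτ.2) fun t _ => hρ0 t)
  have h2 : Real.exp (-(K * τ)) * f τ ≤ f 0 + ∫ s in (0:ℝ)..T, ρ s := by linarith
  have h3 : f τ = Real.exp (K * τ) * (Real.exp (-(K * τ)) * f τ) := by
    rw [← mul_assoc, ← Real.exp_add]; simp
  rw [h3]
  calc _ ≤ Real.exp (K * τ) * (f 0 + ∫ s in (0:ℝ)..T, ρ s) :=
        mul_le_mul_of_nonneg_left h2 (Real.exp_pos _).le
    _ ≤ _ := mul_le_mul_of_nonneg_right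
        (Real.exp_le_exp.2 (mul_le_mul_of_nonneg_left hτ.2 hK)) hpos

/-! ### Abstract Galerkin energy estimate -/

section Galerkin

variable {H : Type*} [NormedAddCommGroup H] [InnerProductSpace ℝ H]

/-- Energy estimate for the Galerkin system
`Z_k' = -ε κ_k² Z_k + ⟪y, A_k⟫ + ⟪g₀, E_k⟫ + ⟪g₁, D_k⟫`, `k < N`. -/
lemma galerkin_energy {N : ℕ} {E D A : ℕ → H} {κ : ℕ → ℝ} {C ε T : ℝ} (hC : 0 ≤ C)
    (hε : 0 < ε) (hε1 : ε ≤ 1) (hE : Orthonormal ℝ E)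
    (hD : ∀ c : ℕ → ℝ, ‖∑ k ∈ Finset.range N, c k • D k‖ ^ 2 =
      ∑ k ∈ Finset.range N, κ k ^ 2 * c k ^ 2)
    (hA1 : ∀ c : ℕ → ℝ, inner ℝ (∑ k ∈ Finset.range N, c k • E k)
      (∑ k ∈ Finset.range N, c k • A k) ≤ C * ‖∑ k ∈ Finset.range N, c k • E k‖ ^ 2)
    (hA2 : ∀ c : ℕ → ℝ, ‖∑ k ∈ Finset.range N, c k • A k‖ ≤
      C * (‖∑ k ∈ Finset.range N, c k • E k‖ + ‖∑ k ∈ Finset.range N, c k • D k‖))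
    {y g₀ g₁ : ℝ → H} (hy : Continuous y) (hg₀ : Continuous g₀) (hg₁ : Continuous g₁)
    {Z : ℕ → ℝ → ℝ} (hZc : ∀ k, Continuous (Z k))
    (hZ : ∀ k < N, ∀ τ ∈ Icc 0 T, Z k τ = Z k 0 + ∫ t in (0:ℝ)..τ, (-(ε * κ k ^ 2 * Z k t) +
      inner ℝ (y t) (A k) + inner ℝ (g₀ t) (E k) + inner ℝ (g₁ t) (D k))) :
    ∀ τ ∈ Icc 0 T, ‖∑ k ∈ Finset.range N, Z k τ • E k‖ ^ 2 ≤
      Real.exp ((2 * C + 2) * T) * (‖∑ k ∈ Finset.range N, Z k 0 • E k‖ ^ 2 +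
        ∫ t in (0:ℝ)..T, (3 * C ^ 2 / ε * ‖y t - ∑ k ∈ Finset.range N, Z k t • E k‖ ^ 2 +
          1 / ε * ‖g₁ t‖ ^ 2 + ‖g₀ t‖ ^ 2)) := by
  set z : ℝ → H := fun t => ∑ k ∈ Finset.range N, Z k t • E k with hz
  set w : ℝ → H := fun t => ∑ k ∈ Finset.range N, Z k t • D k with hw
  set α : ℝ → H := fun t => ∑ k ∈ Finset.range N, Z k t • A k with hα
  have hzc : Continuous z := by fun_prop
  set f : ℕ → ℝ → ℝ := fun k t => -(ε * κ k ^ 2 * Z k t) +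
      inner ℝ (y t) (A k) + inner ℝ (g₀ t) (E k) + inner ℝ (g₁ t) (D k) with hf
  have hfc : ∀ k, Continuous (f k) := fun k => by fun_prop
  have hZd : ∀ k < N, ∀ t ∈ Ioo 0 T, HasDerivAt (Z k) (f k t) t := by
    intro k hk t ht
    have h1 : HasDerivAt (fun τ => Z k 0 + ∫ t in (0:ℝ)..τ, f k t) (f k t) t :=
      (intervalIntegral.integral_hasDerivAt_right ((hfc k).intervalIntegrable _ _)
        ((hfc k).stronglyMeasurableAtFilter _ _) (hfc k).continuousAt).const_add _
    refine h1.congr_of_eventuallyEq ?_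
    filter_upwards [Ioo_mem_nhds ht.1 ht.2] with s hs
    exact hZ k hk s (Ioo_subset_Icc_self hs)
  have hnorm : ∀ t, ‖z t‖ ^ 2 = ∑ k ∈ Finset.range N, Z k t ^ 2 := by
    intro t
    rw [← real_inner_self_eq_norm_sq, hz, hE.inner_sum]
    simp [sq]
  have hder : ∀ t ∈ Ioo 0 T, HasDerivAt (fun t => ‖z t‖ ^ 2)
      (2 * (-(ε * ‖w t‖ ^ 2) + inner ℝ (y t) (α t) + inner ℝ (g₀ t) (z t) +
        inner ℝ (g₁ t) (w t))) t := by
    intro t ht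
    simp_rw [hnorm]
    have h1 : HasDerivAt (fun t => ∑ k ∈ Finset.range N, Z k t ^ 2)
        (∑ k ∈ Finset.range N, 2 * (Z k t * f k t)) t := by
      refine HasDerivAt.fun_sum fun k hk => ?_
      have := (hZd k (Finset.mem_range.1 hk) t ht).pow 2
      refine this.congr_deriv ?_
      push_cast; ring
    refine h1.congr_deriv (Eq.symm ?_)
    rw [hw, hD, hα, hz]
    simp only [inner_sum, inner_smul_right, Finset.mul_sum, ← Finset.sum_neg_distrib,
      ← Finset.sum_add_distrib]
    refine Finset.sum_congr rfl fun k _ => ?_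
    simp only [hf]; ring
  refine gronwall_bound (by linarith) (by fun_prop) (by fun_prop) (fun t => by positivity) hder
    ?_ (by positivity)
  intro t _
  -- The skew structure in `hA1` controls only ⟪z, α⟫. The remainder involves y - z and is estimated
  -- crudely through `hA2`.
  have e1 : inner ℝ (y t) (α t) = inner ℝ (z t) (α t) + inner ℝ (y t - z t) (α t) := by
    rw [inner_sub_left]; ring
  have e2 := hA1 fun k => Z k t
  have e3 := real_inner_le_norm (y t - z t) (α t)
  have e4 := hA2 fun k => Z k t
  have e5 := real_inner_le_norm (g₀ t) (z t)
  have e6 := real_inner_le_norm (g₁ t) (w t)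
  change inner ℝ (z t) (α t) ≤ C * ‖z t‖ ^ 2 at e2
  change ‖α t‖ ≤ C * (‖z t‖ + ‖w t‖) at e4
  have e7 := mul_le_mul_of_nonneg_left e4 (norm_nonneg (y t - z t))
  generalize ‖z t‖ = Zn at *
  generalize ‖w t‖ = d at *
  generalize ‖y t - z t‖ = r at *
  -- Of the dissipation 2ε d², `q1` spends ε/2 and `q2` spends ε. The factor 1/ε in `q3` is not
  -- needed there; ε ≤ 1 merely allows it to be merged with `q1` into 3C²/ε.
  have q1 : 2 * (r * (C * d)) ≤ ε / 2 * d ^ 2 + 2 * C ^ 2 / ε * r ^ 2 := by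
    have : 0 ≤ (ε * d - 2 * C * r) ^ 2 / (2 * ε) := by positivity
    have h : (ε * d - 2 * C * r) ^ 2 / (2 * ε) =
      ε / 2 * d ^ 2 + 2 * C ^ 2 / ε * r ^ 2 - 2 * (r * (C * d)) := by field_simp; ring
    linarith
  have q2 : 2 * (‖g₁ t‖ * d) ≤ ε * d ^ 2 + 1 / ε * ‖g₁ t‖ ^ 2 := by
    have : 0 ≤ (ε * d - ‖g₁ t‖) ^ 2 / ε := by positivity
    have h : (ε * d - ‖g₁ t‖) ^ 2 / ε = ε * d ^ 2 + 1 / ε * ‖g₁ t‖ ^ 2 - 2 * (‖g₁ t‖ * d) := by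
      field_simp; ring
    linarith
  have q3 : 2 * (r * (C * Zn)) ≤ Zn ^ 2 + C ^ 2 / ε * r ^ 2 := by
    have : C ^ 2 * r ^ 2 ≤ C ^ 2 / ε * r ^ 2 := by
      refine mul_le_mul_of_nonneg_right ?_ (sq_nonneg r)
      rw [le_div_iff₀ hε]
      nlinarith [sq_nonneg C]
    nlinarith [sq_nonneg (Zn - C * r)]
  have q4 : 3 * C ^ 2 / ε * r ^ 2 = 2 * C ^ 2 / ε * r ^ 2 + C ^ 2 / ε * r ^ 2 := by ring
  have q5 : 0 ≤ ε * d ^ 2 := by positivity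
  nlinarith [sq_nonneg (Zn - ‖g₀ t‖)]

end Galerkin

/-! ### Functions as elements of L²(0, ℓ) -/

section toL2

/-- The class in `L²(0,ℓ)` of a square integrable function (and `0` otherwise). -/
def toL2 (ℓ : ℝ) (f : ℝ → ℝ) : L2 ℓ :=
  open Classical in if h : MemLp f 2 (volume.restrict (Ioo (0 : ℝ) ℓ)) then h.toLp f else 0

variable {ℓ : ℝ} {f g : ℝ → ℝ}

lemma coeFn_toL2 (hf : MemLp f 2 (volume.restrict (Ioo (0 : ℝ) ℓ))) :
    toL2 ℓ f =ᵐ[volume.restrict (Ioo (0 : ℝ) ℓ)] f := by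
  rw [toL2, dif_pos hf]; exact hf.coeFn_toLp

lemma toL2_coeFn (u : L2 ℓ) : toL2 ℓ u = u := Lp.ext (coeFn_toL2 (Lp.memLp u))

lemma inner_eq_integral (u v : L2 ℓ) : inner ℝ u v = ∫ x in Ioo 0 ℓ, u x * v x := by
  rw [L2.inner_def]
  refine integral_congr_ae (Eventually.of_forall fun x => ?_)
  simp [mul_comm]

lemma integrable_mul_L2 (u v : L2 ℓ) :
    Integrable (fun x => u x * v x) (volume.restrict (Ioo (0 : ℝ) ℓ)) :=
  (Lp.memLp u).integrable_mul (Lp.memLp v)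

lemma inner_toL2 (u : L2 ℓ) (hf : MemLp f 2 (volume.restrict (Ioo (0 : ℝ) ℓ))) :
    inner ℝ u (toL2 ℓ f) = ∫ x in Ioo 0 ℓ, u x * f x := by
  rw [inner_eq_integral]
  refine integral_congr_ae ?_
  filter_upwards [coeFn_toL2 hf] with x hx
  rw [hx]

lemma inner_toL2_toL2 (hf : MemLp f 2 (volume.restrict (Ioo (0 : ℝ) ℓ)))
    (hg : MemLp g 2 (volume.restrict (Ioo (0 : ℝ) ℓ))) :
    inner ℝ (toL2 ℓ f) (toL2 ℓ g) = ∫ x in Ioo 0 ℓ, f x * g x := by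
  rw [inner_toL2 _ hg]
  refine integral_congr_ae ?_
  filter_upwards [coeFn_toL2 hf] with x hx
  rw [hx]

lemma toL2_add (hf : MemLp f 2 (volume.restrict (Ioo (0 : ℝ) ℓ)))
    (hg : MemLp g 2 (volume.restrict (Ioo (0 : ℝ) ℓ))) :
    toL2 ℓ (fun x => f x + g x) = toL2 ℓ f + toL2 ℓ g := by
  refine Lp.ext ?_
  filter_upwards [coeFn_toL2 (hf.add hg), coeFn_toL2 hf, coeFn_toL2 hg,
    Lp.coeFn_add (toL2 ℓ f) (toL2 ℓ g)] with x h1 h2 h3 h4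
  rw [h4]; simp only [Pi.add_apply, h2, h3]; exact h1

lemma toL2_const_mul (c : ℝ) (hf : MemLp f 2 (volume.restrict (Ioo (0 : ℝ) ℓ))) :
    toL2 ℓ (fun x => c * f x) = c • toL2 ℓ f := by
  refine Lp.ext ?_
  filter_upwards [coeFn_toL2 (hf.const_mul c), coeFn_toL2 hf,
    Lp.coeFn_smul c (toL2 ℓ f)] with x h1 h2 h3
  rw [h3, h1, Pi.smul_apply, h2]; rfl

lemma toL2_sum {N : ℕ} {F : ℕ → ℝ → ℝ}
    (hF : ∀ k, MemLp (F k) 2 (volume.restrict (Ioo (0 : ℝ) ℓ))) (c : ℕ → ℝ) :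
    toL2 ℓ (fun x => ∑ k ∈ Finset.range N, c k * F k x) =
      ∑ k ∈ Finset.range N, c k • toL2 ℓ (F k) := by
  induction N with
  | zero =>
    simp only [Finset.range_zero, Finset.sum_empty]
    have := toL2_const_mul (ℓ := ℓ) 0 (hF 0)
    simpa using this
  | succ n ih =>
    simp only [Finset.sum_range_succ]
    rw [toL2_add (memLp_finsetSum _ fun k _ => (hF k).const_mul (c k)) ((hF n).const_mul _), ih,
      toL2_const_mul _ (hF n)]

lemma norm_toL2_le_of_ae_le {M : ℝ} {u : L2 ℓ} (hf : MemLp f 2 (volume.restrict (Ioo (0 : ℝ) ℓ)))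
    (h : ∀ᵐ x ∂volume.restrict (Ioo (0 : ℝ) ℓ), |f x| ≤ M * |u x|) : ‖toL2 ℓ f‖ ≤ M * ‖u‖ := by
  refine Lp.norm_le_mul_norm_of_ae_le_mul ?_
  filter_upwards [h, coeFn_toL2 hf] with x h1 h2
  rw [h2]; exact h1

lemma memLp_of_continuousOn {p : ℝ≥0∞} (hf : ContinuousOn f (Icc 0 ℓ)) :
    MemLp f p (volume.restrict (Ioo (0 : ℝ) ℓ)) := by
  obtain ⟨C, hC⟩ := isCompact_Icc.exists_bound_of_continuousOn hf
  refine MemLp.of_bound ((hf.mono Ioo_subset_Icc_self).aestronglyMeasurable measurableSet_Ioo) C ?_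
  filter_upwards [ae_restrict_mem measurableSet_Ioo] with x hx
  exact hC x (Ioo_subset_Icc_self hx)

lemma integral_Ioo_eq_intervalIntegral (hℓ : 0 ≤ ℓ) (f : ℝ → ℝ) :
    ∫ x in Ioo 0 ℓ, f x = ∫ x in (0:ℝ)..ℓ, f x := by
  rw [intervalIntegral.integral_of_le hℓ, integral_Ioc_eq_integral_Ioo]

end toL2

/-! ### The Dirichlet sine basis -/

section Sine

/-- The frequency `(k+1)π/L`. -/
def freq (L : ℝ) (k : ℕ) : ℝ := (k + 1) * (Real.pi / L)

/-- The normalised eigenfunctions of the Dirichlet Laplacian on `(0,L)`. -/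
def mode (L : ℝ) (k : ℕ) (x : ℝ) : ℝ := √(2 / L) * Real.sin (freq L k * x)

/-- The derivative of `mode L k`. -/
def dmode (L : ℝ) (k : ℕ) (x : ℝ) : ℝ := √(2 / L) * (freq L k * Real.cos (freq L k * x))

variable {L : ℝ}

lemma freq_pos (hL : 0 < L) (k : ℕ) : 0 < freq L k := by
  unfold freq; have := Real.pi_pos; positivity

lemma continuous_mode (k : ℕ) : Continuous (mode L k) := by unfold mode; fun_prop

lemma continuous_dmode (k : ℕ) : Continuous (dmode L k) := by unfold dmode; fun_prop

lemma hasDerivAt_mode (k : ℕ) (x : ℝ) : HasDerivAt (mode L k) (dmode L k x) x := by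
  have h : HasDerivAt (fun x => freq L k * x) (freq L k) x := by
    simpa using (hasDerivAt_id x).const_mul (freq L k)
  refine (h.sin.const_mul (√(2 / L))).congr_deriv ?_
  unfold dmode; ring

lemma hasDerivAt_dmode (k : ℕ) (x : ℝ) :
    HasDerivAt (dmode L k) (-(freq L k ^ 2 * mode L k x)) x := by
  have h : HasDerivAt (fun x => freq L k * x) (freq L k) x := by
    simpa using (hasDerivAt_id x).const_mul (freq L k)
  refine ((h.cos.const_mul (freq L k)).const_mul (√(2 / L))).congr_deriv ?_
  unfold mode; ring

lemma mode_zero (k : ℕ) : mode L k 0 = 0 := by simp [mode]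

lemma mode_right (hL : 0 < L) (k : ℕ) : mode L k L = 0 := by
  have : freq L k * L = ((k + 1 : ℕ) : ℝ) * Real.pi := by unfold freq; push_cast; field_simp
  rw [mode, this, Real.sin_nat_mul_pi, mul_zero]

lemma memLp_mode {p : ℝ≥0∞} (k : ℕ) : MemLp (mode L k) p (volume.restrict (Ioo (0 : ℝ) L)) :=
  memLp_of_continuousOn (continuous_mode k).continuousOn

lemma memLp_dmode {p : ℝ≥0∞} (k : ℕ) : MemLp (dmode L k) p (volume.restrict (Ioo (0 : ℝ) L)) :=
  memLp_of_continuousOn (continuous_dmode k).continuousOn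

lemma integral_cos_nat (hL : 0 < L) {n : ℤ} (hn : n ≠ 0) :
    ∫ x in (0:ℝ)..L, Real.cos (n * (Real.pi / L) * x) = 0 := by
  have hc : (n : ℝ) * (Real.pi / L) ≠ 0 := by
    have := Real.pi_pos
    have : (n : ℝ) ≠ 0 := by exact_mod_cast hn
    positivity
  rw [intervalIntegral.integral_comp_mul_left (fun x => Real.cos x) hc, integral_cos]
  have : (n : ℝ) * (Real.pi / L) * L = n * Real.pi := by field_simp
  rw [this, Real.sin_int_mul_pi]; simp

lemma orthonormal_mode (hL : 0 < L) : Orthonormal ℝ fun k => toL2 L (mode L k) := by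
  rw [orthonormal_iff_ite]
  intro i j
  rw [inner_toL2_toL2 (memLp_mode i) (memLp_mode j), integral_Ioo_eq_intervalIntegral hL.le]
  have h1 : ∀ x, mode L i x * mode L j x = (1 / L) *
      (Real.cos (((i : ℤ) - (j : ℤ) : ℤ) * (Real.pi / L) * x) -
        Real.cos (((i : ℤ) + (j : ℤ) + 2 : ℤ) * (Real.pi / L) * x)) := by
    intro x
    have h2 : √(2 / L) * √(2 / L) = 2 / L := Real.mul_self_sqrt (by positivity)
    have h3 : (((i : ℤ) - (j : ℤ) : ℤ) : ℝ) * (Real.pi / L) * x = freq L i * x - freq L j * x := by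
      unfold freq; push_cast; ring
    have h4 : (((i : ℤ) + (j : ℤ) + 2 : ℤ) : ℝ) * (Real.pi / L) * x =
        freq L i * x + freq L j * x := by
      unfold freq; push_cast; ring
    rw [h3, h4, Real.cos_sub, Real.cos_add, mode, mode]
    linear_combination (Real.sin (freq L i * x) * Real.sin (freq L j * x)) * h2
  simp_rw [h1]
  rw [intervalIntegral.integral_const_mul, intervalIntegral.integral_sub
    (Continuous.intervalIntegrable (by fun_prop) _ _)
    (Continuous.intervalIntegrable (by fun_prop) _ _), integral_cos_nat hL (n := i + j + 2) (by omega)]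
  split_ifs with hij
  · subst hij
    simp [hL.ne']
  · rw [integral_cos_nat hL (by omega)]; simp

/-- The recurrence 2X U_n = U_{n+1} + U_{n-1}, with U_{-1} = 0, makes the span stable under
multiplication by X. It serves the completeness of the sines, through sin((n+1)θ) = U_n(cos θ) sin
θ. -/
lemma mem_span_chebyshevU (p : Polynomial ℝ) :
    p ∈ Submodule.span ℝ (range fun n : ℕ => Polynomial.Chebyshev.U ℝ n) := by
  set M := Submodule.span ℝ (range fun n : ℕ => Polynomial.Chebyshev.U ℝ n) with hM
  have hU : ∀ n : ℕ, Polynomial.Chebyshev.U ℝ n ∈ M := fun n => Submodule.subset_span ⟨n, rfl⟩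
  have hX : ∀ q ∈ M, Polynomial.X * q ∈ M := by
    intro q hq
    induction hq using Submodule.span_induction with
    | mem q hq =>
      obtain ⟨n, rfl⟩ := hq
      have h1 : Polynomial.X * Polynomial.Chebyshev.U ℝ n = (1 / 2 : ℝ) •
          (Polynomial.Chebyshev.U ℝ ((n + 1 : ℕ) : ℤ) + Polynomial.Chebyshev.U ℝ ((n : ℤ) - 1)) := by
        have := Polynomial.Chebyshev.U_eq ℝ ((n : ℤ) + 1)
        rw [show ((n : ℤ) + 1 - 2) = (n : ℤ) - 1 by ring, add_sub_cancel_right] at this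
        push_cast
        rw [this, Polynomial.smul_eq_C_mul]
        have h2 : Polynomial.C (1 / 2 : ℝ) * 2 = 1 := by
          rw [← Polynomial.C_ofNat, ← Polynomial.C_mul]; norm_num
        linear_combination (-(Polynomial.X * Polynomial.Chebyshev.U ℝ n)) * h2
      show Polynomial.X * Polynomial.Chebyshev.U ℝ n ∈ M
      rw [h1]
      refine M.smul_mem _ (M.add_mem (hU _) ?_)
      cases n with
      | zero => simp
      | succ m => simpa using hU m
    | zero => simp
    | add x y _ _ hx hy => rw [mul_add]; exact M.add_mem hx hy
    | smul c x _ hx => rw [mul_smul_comm]; exact M.smul_mem _ hx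
  have hXn : ∀ n : ℕ, Polynomial.X ^ n ∈ M := by
    intro n
    induction n with
    | zero => simpa using hU 0
    | succ n ih => rw [pow_succ']; exact hX _ ih
  rw [p.as_sum_range_C_mul_X_pow]
  refine M.sum_mem fun i _ => ?_
  rw [← Polynomial.smul_eq_C_mul]
  exact M.smul_mem _ (hXn i)

/-- The sine functions are complete in `L²(0,L)`. -/
lemma eq_zero_of_inner_mode (hL : 0 < L) (u : L2 L)
    (hu : ∀ k, inner ℝ u (toL2 L (mode L k)) = 0) : u = 0 := by
  set μ := volume.restrict (Ioo (0 : ℝ) L) with hμ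
  have hui : Integrable u μ := (Lp.memLp u).integrable one_le_two
  set θ : ℝ := Real.pi / L with hθ
  have hθ0 : 0 < θ := div_pos Real.pi_pos hL
  have hmul : ∀ g : ℝ → ℝ, Continuous g → (∃ C, ∀ x, |g x| ≤ C) →
      Integrable (fun x => u x * g x) μ := by
    rintro g hg ⟨C, hC⟩
    exact hui.mul_bdd (c := C) hg.aestronglyMeasurable (Eventually.of_forall hC)
  have hpoly : ∀ p : Polynomial ℝ, Integrable
      (fun x => u x * (p.eval (Real.cos (θ * x)) * Real.sin (θ * x))) μ := by
    intro p
    refine hmul _ (by fun_prop) ?_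
    obtain ⟨C, hC⟩ := isCompact_Icc.exists_bound_of_continuousOn
      (p.continuous.continuousOn (s := Icc (-1) 1))
    refine ⟨C, fun x => ?_⟩
    rw [abs_mul]
    have h1 := hC _ (Real.cos_mem_Icc (θ * x))
    have h2 := Real.abs_sin_le_one (θ * x)
    rw [Real.norm_eq_abs] at h1
    nlinarith [abs_nonneg (p.eval (Real.cos (θ * x))), abs_nonneg (Real.sin (θ * x))]
  have hp : ∀ p : Polynomial ℝ,
      ∫ x, u x * (p.eval (Real.cos (θ * x)) * Real.sin (θ * x)) ∂μ = 0 := by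
    intro p
    induction mem_span_chebyshevU p using Submodule.span_induction with
    | mem q hq =>
      obtain ⟨n, rfl⟩ := hq
      have h := hu n
      rw [inner_toL2 _ (memLp_mode n)] at h
      have h1 : ∀ x, u x * mode L n x = √(2 / L) * (u x *
          ((Polynomial.Chebyshev.U ℝ n).eval (Real.cos (θ * x)) * Real.sin (θ * x))) := by
        intro x
        rw [Polynomial.Chebyshev.U_real_cos, mode, freq]
        push_cast
        rw [mul_assoc ((n : ℝ) + 1), ← hθ]; ring
      simp_rw [h1] at h
      rw [integral_const_mul] at h
      exact (mul_eq_zero.1 h).resolve_left (Real.sqrt_pos.2 (by positivity)).ne'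
    | zero => simp
    | add p q _ _ hp hq =>
      simp only [Polynomial.eval_add, add_mul, mul_add]
      rw [integral_add (hpoly p) (hpoly q), hp, hq, add_zero]
    | smul c p _ hp =>
      simp only [Polynomial.eval_smul, smul_eq_mul]
      have : ∀ x, u x * (c * p.eval (Real.cos (θ * x)) * Real.sin (θ * x)) =
        c * (u x * (p.eval (Real.cos (θ * x)) * Real.sin (θ * x))) := fun x => by ring
      simp_rw [this]
      rw [integral_const_mul, hp, mul_zero]
  -- On (0, L) the map x ↦ cos(πx/L) is invertible by arccos, so g is a continuous function of the
  -- cosine and Weierstrass approximation on [-1, 1] reduces to the polynomial case.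
  have hcont : ∀ g : ℝ → ℝ, Continuous g → (∃ C, ∀ x, |g x| ≤ C) →
      ∫ x, u x * (g x * Real.sin (θ * x)) ∂μ = 0 := by
    rintro g hg ⟨C, hC⟩
    have hgi : Integrable (fun x => u x * (g x * Real.sin (θ * x))) μ := by
      refine hmul _ (by fun_prop) ⟨C, fun x => ?_⟩
      rw [abs_mul]
      nlinarith [hC x, Real.abs_sin_le_one (θ * x), abs_nonneg (g x),
        abs_nonneg (Real.sin (θ * x))]
    have hbound : ∀ η > 0, |∫ x, u x * (g x * Real.sin (θ * x)) ∂μ| ≤ η * ∫ x, |u x| ∂μ := by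
      intro η hη
      obtain ⟨p, hpη⟩ := exists_polynomial_near_of_continuousOn (-1) 1
        (fun v => g (Real.arccos v / θ))
        ((hg.comp (Real.continuous_arccos.div_const θ)).continuousOn) η hη
      have h1 : ∫ x, u x * (g x * Real.sin (θ * x)) ∂μ =
          ∫ x, (u x * (g x * Real.sin (θ * x)) -
            u x * (p.eval (Real.cos (θ * x)) * Real.sin (θ * x))) ∂μ := by
        rw [integral_sub hgi (hpoly p), hp, sub_zero]
      rw [h1, ← integral_const_mul, ← Real.norm_eq_abs]
      refine norm_integral_le_of_norm_le (hui.abs.const_mul η) ?_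
      filter_upwards [ae_restrict_mem measurableSet_Ioo] with x hx
      have h2 := hpη _ (Real.cos_mem_Icc (θ * x))
      have h3 : Real.arccos (Real.cos (θ * x)) = θ * x := by
        refine Real.arccos_cos (by nlinarith [hx.1]) ?_
        calc θ * x ≤ θ * L := by nlinarith [hx.2]
          _ = Real.pi := by rw [hθ]; field_simp
      simp only [h3, mul_div_cancel_left₀ x hθ0.ne'] at h2
      have h4 : u x * (g x * Real.sin (θ * x)) -
          u x * (p.eval (Real.cos (θ * x)) * Real.sin (θ * x)) =
          -(u x * ((p.eval (Real.cos (θ * x)) - g x) * Real.sin (θ * x))) := by ring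
      rw [h4, norm_neg, Real.norm_eq_abs, abs_mul, abs_mul, mul_comm η]
      refine mul_le_mul_of_nonneg_left ?_ (abs_nonneg _)
      nlinarith [Real.abs_sin_le_one (θ * x), abs_nonneg (Real.sin (θ * x)),
        abs_nonneg (p.eval (Real.cos (θ * x)) - g x)]
    by_contra hne
    have hpos := abs_pos.2 hne
    set I := ∫ x, |u x| ∂μ
    have hI : 0 ≤ I := integral_nonneg fun x => abs_nonneg _
    have := hbound (|∫ x, u x * (g x * Real.sin (θ * x)) ∂μ| / (2 * (I + 1))) (by positivity)
    rw [div_mul_eq_mul_div, le_div_iff₀ (by positivity)] at this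
    nlinarith
  -- By the fundamental lemma of the calculus of variations u(x) sin(πx/L) vanishes almost
  -- everywhere; the sine is positive on (0, L), so u does too.
  have hF : ∀ᵐ x, (Ioo (0:ℝ) L).indicator (fun x => u x * Real.sin (θ * x)) x = 0 := by
    refine ae_eq_zero_of_integral_contDiff_smul_eq_zero ?_ ?_
    · refine Integrable.locallyIntegrable ?_
      rw [integrable_indicator_iff measurableSet_Ioo]
      exact hmul _ (by fun_prop) ⟨1, fun x => Real.abs_sin_le_one _⟩
    · intro g hg hgs
      have h1 : ∀ x, g x • (Ioo (0:ℝ) L).indicator (fun x => u x * Real.sin (θ * x)) x =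
          (Ioo (0:ℝ) L).indicator (fun x => u x * (g x * Real.sin (θ * x))) x := by
        intro x
        by_cases hx : x ∈ Ioo (0:ℝ) L
        · simp only [indicator_of_mem hx, smul_eq_mul]; ring
        · simp [indicator_of_notMem hx]
      simp_rw [h1]
      rw [integral_indicator measurableSet_Ioo]
      obtain ⟨C, hC⟩ := hg.continuous.bounded_above_of_compact_support hgs
      exact hcont g hg.continuous ⟨C, hC⟩
  refine Lp.ext ?_
  filter_upwards [ae_restrict_of_ae hF, ae_restrict_mem measurableSet_Ioo,
    Lp.coeFn_zero ℝ 2 μ] with x h1 h2 h3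
  rw [indicator_of_mem h2] at h1
  rw [h3]
  refine (mul_eq_zero.1 h1).resolve_right (Real.sin_pos_of_pos_of_lt_pi (by nlinarith [h2.1]) ?_).ne'
  calc θ * x < θ * L := by nlinarith [h2.2]
    _ = Real.pi := by rw [hθ]; field_simp

/-- The Hilbert basis of sines. -/
def sineBasis (hL : 0 < L) : HilbertBasis ℕ ℝ (L2 L) :=
  HilbertBasis.mkOfOrthogonalEqBot (orthonormal_mode hL) <| by
    rw [Submodule.eq_bot_iff]
    intro u hu
    refine eq_zero_of_inner_mode hL u fun k => ?_
    rw [real_inner_comm]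
    exact (Submodule.mem_orthogonal _ _).1 hu _ (Submodule.subset_span ⟨k, rfl⟩)

lemma coe_sineBasis (hL : 0 < L) : ⇑(sineBasis hL) = fun k => toL2 L (mode L k) :=
  HilbertBasis.coe_mkOfOrthogonalEqBot _ _

/-- The partial sums of the sine series. -/
def proj (L : ℝ) (N : ℕ) (u : L2 L) : L2 L :=
  ∑ k ∈ Finset.range N, inner ℝ u (toL2 L (mode L k)) • toL2 L (mode L k)

lemma continuous_proj (N : ℕ) : Continuous (proj L N) := by
  unfold proj; fun_prop

lemma tendsto_proj (hL : 0 < L) (u : L2 L) : Tendsto (fun N => proj L N u) atTop (𝓝 u) := by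
  have := ((sineBasis hL).hasSum_repr u).tendsto_sum_nat
  refine this.congr fun N => Finset.sum_congr rfl fun k _ => ?_
  erw [HilbertBasis.repr_apply_apply]
  rw [coe_sineBasis, real_inner_comm]

/-- Orthonormality gives ‖Pu‖² = ⟪u, Pu⟫, and Cauchy–Schwarz concludes. -/
lemma norm_proj_le (hL : 0 < L) (N : ℕ) (u : L2 L) : ‖proj L N u‖ ≤ ‖u‖ := by
  have h1 : inner ℝ (proj L N u) (proj L N u) = inner ℝ u (proj L N u) := by
    conv_lhs => rw [proj, (orthonormal_mode hL).inner_sum]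
    simp [proj, inner_sum, inner_smul_right]
  rw [real_inner_self_eq_norm_sq] at h1
  have h2 := real_inner_le_norm u (proj L N u)
  by_contra h
  push Not at h
  nlinarith [norm_nonneg u, norm_nonneg (proj L N u)]

lemma norm_sub_proj_le (hL : 0 < L) (N : ℕ) (u : L2 L) : ‖u - proj L N u‖ ≤ 2 * ‖u‖ := by
  have := norm_sub_le u (proj L N u)
  linarith [norm_proj_le hL N u]

end Sine

/-! ### The first order operator on trigonometric sums -/

section Transport

variable {a b : ℝ → ℝ} {L : ℝ}

/-- A common bound for `a`, `a'` on `[0,L]` and for `b` almost everywhere. -/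
structure CoeffBound (a b : ℝ → ℝ) (L C : ℝ) : Prop where
  nonneg : 0 ≤ C
  coeff : ∀ x ∈ Icc 0 L, |a x| ≤ C
  deriv : ∀ x ∈ Icc 0 L, |derivWithin a (Icc 0 L) x| ≤ C
  zeroth : ∀ᵐ x ∂volume.restrict (Ioo 0 L), |b x| ≤ C

lemma continuousOn_derivWithin_coeff (hL : 0 < L) (ha : ContDiffOn ℝ 1 a (Icc 0 L)) :
    ContinuousOn (derivWithin a (Icc 0 L)) (Icc 0 L) :=
  ha.continuousOn_derivWithin (uniqueDiffOn_Icc hL) le_rfl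

lemma exists_bound_ae_of_memLp_top {k : ℝ → ℝ} (hk : MemLp k ⊤ (volume.restrict (Ioo 0 L))) :
    ∃ B, 0 ≤ B ∧ ∀ᵐ x ∂volume.restrict (Ioo 0 L), |k x| ≤ B := by
  refine ⟨(eLpNorm k ⊤ (volume.restrict (Ioo 0 L))).toReal, ENNReal.toReal_nonneg, ?_⟩
  rw [eLpNorm_exponent_top]
  filter_upwards [ae_le_eLpNormEssSup (f := k) (μ := volume.restrict (Ioo 0 L))] with x hx
  have htop : eLpNormEssSup k (volume.restrict (Ioo 0 L)) ≠ ⊤ := by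
    rw [← eLpNorm_exponent_top]; exact hk.eLpNorm_ne_top
  have := ENNReal.toReal_mono htop hx
  simpa using this

lemma exists_coeffBound (hL : 0 < L) (ha : ContDiffOn ℝ 1 a (Icc 0 L))
    (hb : MemLp b ⊤ (volume.restrict (Ioo 0 L))) : ∃ C, CoeffBound a b L C := by
  obtain ⟨C₁, h₁⟩ := isCompact_Icc.exists_bound_of_continuousOn ha.continuousOn
  obtain ⟨C₂, h₂⟩ := isCompact_Icc.exists_bound_of_continuousOn
    (continuousOn_derivWithin_coeff hL ha)
  obtain ⟨B, h0, h₃⟩ := exists_bound_ae_of_memLp_top hb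
  refine ⟨|C₁| + |C₂| + B, by positivity, fun x hx => ?_, fun x hx => ?_, ?_⟩
  · have := h₁ x hx
    rw [Real.norm_eq_abs] at this
    linarith [le_abs_self C₁, abs_nonneg C₂]
  · have := h₂ x hx
    rw [Real.norm_eq_abs] at this
    linarith [le_abs_self C₂, abs_nonneg C₁]
  · filter_upwards [h₃] with x hx
    linarith [abs_nonneg C₁, abs_nonneg C₂]

/-- The first order part `a f' + (a' - b) f` of the adjoint operator applied to `mode L k`. -/
def transportMode (a b : ℝ → ℝ) (L : ℝ) (k : ℕ) (x : ℝ) : ℝ :=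
  a x * dmode L k x + (derivWithin a (Icc 0 L) x - b x) * mode L k x

lemma memLp_zeroth (hL : 0 < L) (ha : ContDiffOn ℝ 1 a (Icc 0 L))
    (hb : MemLp b ⊤ (volume.restrict (Ioo 0 L))) :
    MemLp (fun x => derivWithin a (Icc 0 L) x - b x) ⊤ (volume.restrict (Ioo 0 L)) :=
  (memLp_of_continuousOn (continuousOn_derivWithin_coeff hL ha)).sub hb

lemma memLp_top_mul {f g : ℝ → ℝ} (hf : MemLp f ⊤ (volume.restrict (Ioo 0 L)))
    (hg : MemLp g 2 (volume.restrict (Ioo 0 L))) :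
    MemLp (fun x => f x * g x) 2 (volume.restrict (Ioo 0 L)) :=
  hg.mul (p := ⊤) (q := 2) (r := 2) hf

lemma memLp_transportMode (hL : 0 < L) (ha : ContDiffOn ℝ 1 a (Icc 0 L))
    (hb : MemLp b ⊤ (volume.restrict (Ioo 0 L))) (k : ℕ) :
    MemLp (transportMode a b L k) 2 (volume.restrict (Ioo 0 L)) :=
  (memLp_top_mul (memLp_of_continuousOn ha.continuousOn) (memLp_dmode k)).add
    (memLp_top_mul (memLp_zeroth hL ha hb) (memLp_mode k))

variable (L) in
/-- A trigonometric sum. -/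
def trigSum (N : ℕ) (c : ℕ → ℝ) (x : ℝ) : ℝ := ∑ k ∈ Finset.range N, c k * mode L k x

variable (L) in
/-- The derivative of a trigonometric sum. -/
def dtrigSum (N : ℕ) (c : ℕ → ℝ) (x : ℝ) : ℝ := ∑ k ∈ Finset.range N, c k * dmode L k x

lemma continuous_trigSum (N : ℕ) (c : ℕ → ℝ) : Continuous (trigSum L N c) := by
  unfold trigSum
  exact continuous_finsetSum _ fun k _ => continuous_const.mul (continuous_mode k)

lemma continuous_dtrigSum (N : ℕ) (c : ℕ → ℝ) : Continuous (dtrigSum L N c) := by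
  unfold dtrigSum
  exact continuous_finsetSum _ fun k _ => continuous_const.mul (continuous_dmode k)

lemma hasDerivAt_trigSum (N : ℕ) (c : ℕ → ℝ) (x : ℝ) :
    HasDerivAt (trigSum L N c) (dtrigSum L N c x) x :=
  HasDerivAt.fun_sum fun k _ => (hasDerivAt_mode k x).const_mul (c k)

lemma hasDerivAt_dtrigSum (N : ℕ) (c : ℕ → ℝ) (x : ℝ) :
    HasDerivAt (dtrigSum L N c) (-(trigSum L N (fun k => freq L k ^ 2 * c k) x)) x := by
  have := HasDerivAt.fun_sum (u := Finset.range N) fun k _ => (hasDerivAt_dmode (L := L) k x).const_mul (c k)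
  refine this.congr_deriv ?_
  rw [trigSum, ← Finset.sum_neg_distrib]
  exact Finset.sum_congr rfl fun k _ => by ring

lemma trigSum_zero (N : ℕ) (c : ℕ → ℝ) : trigSum L N c 0 = 0 := by simp [trigSum, mode_zero]

lemma trigSum_right (hL : 0 < L) (N : ℕ) (c : ℕ → ℝ) : trigSum L N c L = 0 := by
  simp [trigSum, mode_right hL]

lemma toL2_trigSum (N : ℕ) (c : ℕ → ℝ) :
    ∑ k ∈ Finset.range N, c k • toL2 L (mode L k) = toL2 L (trigSum L N c) :=
  (toL2_sum (fun k => memLp_mode k) c).symm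

lemma toL2_dtrigSum (N : ℕ) (c : ℕ → ℝ) :
    ∑ k ∈ Finset.range N, c k • toL2 L (dmode L k) = toL2 L (dtrigSum L N c) :=
  (toL2_sum (fun k => memLp_dmode k) c).symm

lemma toL2_transportSum (hL : 0 < L) (ha : ContDiffOn ℝ 1 a (Icc 0 L))
    (hb : MemLp b ⊤ (volume.restrict (Ioo 0 L))) (N : ℕ) (c : ℕ → ℝ) :
    ∑ k ∈ Finset.range N, c k • toL2 L (transportMode a b L k) =
      toL2 L (fun x => a x * dtrigSum L N c x +
        (derivWithin a (Icc 0 L) x - b x) * trigSum L N c x) := by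
  rw [← toL2_sum (fun k => memLp_transportMode hL ha hb k) c]
  congr 1
  funext x
  simp only [transportMode, trigSum, dtrigSum, Finset.mul_sum, ← Finset.sum_add_distrib]
  exact Finset.sum_congr rfl fun k _ => by ring

/-- Integration by parts turns ‖z'‖² into -⟪z, z''⟫; the boundary terms disappear because z vanishes
at 0 and L. This identifies the dissipation in `galerkin_energy`. -/
lemma norm_sq_dtrigSum (hL : 0 < L) (N : ℕ) (c : ℕ → ℝ) :
    ‖∑ k ∈ Finset.range N, c k • toL2 L (dmode L k)‖ ^ 2 =
      ∑ k ∈ Finset.range N, freq L k ^ 2 * c k ^ 2 := by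
  have hmz := fun c => memLp_of_continuousOn (p := 2) (ℓ := L)
    (continuous_trigSum (L := L) N c).continuousOn
  have hmd := fun c => memLp_of_continuousOn (p := 2) (ℓ := L)
    (continuous_dtrigSum (L := L) N c).continuousOn
  set c' : ℕ → ℝ := fun k => freq L k ^ 2 * c k
  have h1 : inner ℝ (toL2 L (trigSum L N c)) (toL2 L (trigSum L N c')) =
      ∑ k ∈ Finset.range N, freq L k ^ 2 * c k ^ 2 := by
    rw [← toL2_trigSum, ← toL2_trigSum, (orthonormal_mode hL).inner_sum]
    refine Finset.sum_congr rfl fun k _ => ?_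
    simp only [c', conj_trivial]; ring
  rw [toL2_dtrigSum, ← real_inner_self_eq_norm_sq, ← h1, inner_toL2_toL2 (hmd c) (hmd c),
    inner_toL2_toL2 (hmz c) (hmz c'), integral_Ioo_eq_intervalIntegral hL.le,
    integral_Ioo_eq_intervalIntegral hL.le]
  have hcz := fun c => continuous_trigSum (L := L) N c
  have hcd := fun c => continuous_dtrigSum (L := L) N c
  have h2 := intervalIntegral.integral_mul_deriv_eq_deriv_mul (a := 0) (b := L)
    (u := dtrigSum L N c) (v := trigSum L N c) (fun x _ => hasDerivAt_dtrigSum N c x)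
    (fun x _ => hasDerivAt_trigSum N c x) ((hcz c').neg.intervalIntegrable _ _)
    ((hcd c).intervalIntegrable _ _)
  rw [h2, trigSum_zero, trigSum_right hL]
  simp only [mul_zero, sub_zero, neg_mul, intervalIntegral.integral_neg, zero_sub, neg_neg]
  exact intervalIntegral.integral_congr fun x _ => mul_comm _ _

lemma norm_transportSum_le {C : ℝ} (hC : CoeffBound a b L C) (hL : 0 < L)
    (ha : ContDiffOn ℝ 1 a (Icc 0 L))
    (hb : MemLp b ⊤ (volume.restrict (Ioo 0 L))) (N : ℕ) (c : ℕ → ℝ) :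
    ‖∑ k ∈ Finset.range N, c k • toL2 L (transportMode a b L k)‖ ≤
      2 * C * (‖∑ k ∈ Finset.range N, c k • toL2 L (mode L k)‖ +
        ‖∑ k ∈ Finset.range N, c k • toL2 L (dmode L k)‖) := by
  have hmz := memLp_of_continuousOn (p := 2) (ℓ := L)
    (continuous_trigSum (L := L) N c).continuousOn
  have hmd := memLp_of_continuousOn (p := 2) (ℓ := L)
    (continuous_dtrigSum (L := L) N c).continuousOn
  have hm1 := memLp_top_mul (memLp_of_continuousOn ha.continuousOn) hmd
  have hm2 := memLp_top_mul (memLp_zeroth hL ha hb) hmz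
  rw [toL2_transportSum hL ha hb, toL2_add hm1 hm2, toL2_dtrigSum, toL2_trigSum]
  have h1 : ‖toL2 L (fun x => a x * dtrigSum L N c x)‖ ≤ C * ‖toL2 L (dtrigSum L N c)‖ := by
    refine norm_toL2_le_of_ae_le hm1 ?_
    filter_upwards [ae_restrict_mem measurableSet_Ioo, coeFn_toL2 hmd] with x hx h
    rw [h, abs_mul]
    exact mul_le_mul_of_nonneg_right (hC.coeff x (Ioo_subset_Icc_self hx)) (abs_nonneg _)
  have h2 : ‖toL2 L (fun x => (derivWithin a (Icc 0 L) x - b x) * trigSum L N c x)‖ ≤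
      2 * C * ‖toL2 L (trigSum L N c)‖ := by
    refine norm_toL2_le_of_ae_le hm2 ?_
    filter_upwards [ae_restrict_mem measurableSet_Ioo, coeFn_toL2 hmz, hC.zeroth] with x hx h h3
    rw [h, abs_mul]
    refine mul_le_mul_of_nonneg_right ?_ (abs_nonneg _)
    have := hC.deriv x (Ioo_subset_Icc_self hx)
    exact (abs_sub _ _).trans (by linarith)
  have h3 := norm_add_le (toL2 L (fun x => a x * dtrigSum L N c x))
    (toL2 L (fun x => (derivWithin a (Icc 0 L) x - b x) * trigSum L N c x))
  nlinarith [norm_nonneg (toL2 L (dtrigSum L N c)), hC.nonneg]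

/-- Since a z z' = ((a z²)' - a' z²)/2 and z vanishes at both ends, no derivative of z survives:
transport costs only a multiple of ‖z‖², independent of N and ε. -/
lemma inner_transportSum_le {C : ℝ} (hC : CoeffBound a b L C) (hL : 0 < L)
    (ha : ContDiffOn ℝ 1 a (Icc 0 L))
    (hb : MemLp b ⊤ (volume.restrict (Ioo 0 L))) (N : ℕ) (c : ℕ → ℝ) :
    inner ℝ (∑ k ∈ Finset.range N, c k • toL2 L (mode L k))
      (∑ k ∈ Finset.range N, c k • toL2 L (transportMode a b L k)) ≤
      2 * C * ‖∑ k ∈ Finset.range N, c k • toL2 L (mode L k)‖ ^ 2 := by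
  have hcz := continuous_trigSum (L := L) N c
  have hcd := continuous_dtrigSum (L := L) N c
  have hmz := memLp_of_continuousOn (p := 2) (ℓ := L) hcz.continuousOn
  have hmd := memLp_of_continuousOn (p := 2) (ℓ := L) hcd.continuousOn
  have hm1 := memLp_top_mul (memLp_of_continuousOn ha.continuousOn) hmd
  have hm2 := memLp_top_mul (memLp_zeroth hL ha hb) hmz
  have hm12 : MemLp (fun x => a x * dtrigSum L N c x +
      (derivWithin a (Icc 0 L) x - b x) * trigSum L N c x) 2 (volume.restrict (Ioo 0 L)) :=
    hm1.add hm2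
  rw [toL2_transportSum hL ha hb, toL2_trigSum, ← real_inner_self_eq_norm_sq,
    inner_toL2_toL2 hmz hm12, inner_toL2_toL2 hmz hmz]
  set z := trigSum L N c
  set z' := dtrigSum L N c
  set a' := derivWithin a (Icc 0 L) with ha'
  have hca' := continuousOn_derivWithin_coeff hL ha
  have had : ∀ x ∈ Ioo 0 L, HasDerivAt a (a' x) x := fun x hx =>
    ((ha.differentiableOn one_ne_zero) x (Ioo_subset_Icc_self hx)).hasDerivWithinAt.hasDerivAt
      (Icc_mem_nhds hx.1 hx.2)
  have hq : ContinuousOn (fun x => a' x * z x ^ 2 + a x * (2 * z x * z' x)) (Icc 0 L) := by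
    have := ha.continuousOn
    fun_prop
  have hzero : ∫ x in Ioo 0 L, (a' x * z x ^ 2 + a x * (2 * z x * z' x)) = 0 := by
    rw [integral_Ioo_eq_intervalIntegral hL.le,
      intervalIntegral.integral_eq_sub_of_hasDerivAt_of_le hL.le (f := fun x => a x * z x ^ 2)]
    · simp [z, trigSum_zero, trigSum_right hL]
    · have := ha.continuousOn
      fun_prop
    · intro x hx
      refine ((had x hx).mul ((hasDerivAt_trigSum N c x).pow 2)).congr_deriv ?_
      simp only [Pi.pow_apply]
      push_cast; ring
    · exact hq.intervalIntegrable_of_Icc hL.le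
  have hi1 : Integrable (fun x => z x * (a x * z' x + (a' x - b x) * z x))
      (volume.restrict (Ioo 0 L)) := hmz.integrable_mul hm12
  have hi2 : Integrable (fun x => 2⁻¹ * (a' x * z x ^ 2 + a x * (2 * z x * z' x)))
      (volume.restrict (Ioo 0 L)) :=
    ((hq.integrableOn_Icc).mono_set Ioo_subset_Icc_self).const_mul _
  have hzz : Integrable (fun x => z x * z x) (volume.restrict (Ioo 0 L)) := hmz.integrable_mul hmz
  have h2 : ∫ x in Ioo 0 L, z x * (a x * z' x + (a' x - b x) * z x) =
      ∫ x in Ioo 0 L, (z x * (a x * z' x + (a' x - b x) * z x) -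
        2⁻¹ * (a' x * z x ^ 2 + a x * (2 * z x * z' x))) := by
    rw [integral_sub hi1 hi2, integral_const_mul, hzero]; ring
  rw [h2, ← integral_const_mul]
  refine integral_mono_ae (hi1.sub hi2) (hzz.const_mul _) ?_
  filter_upwards [ae_restrict_mem measurableSet_Ioo, hC.zeroth] with x hx h3
  have h4 := hC.deriv x (Ioo_subset_Icc_self hx)
  have h5 := abs_le.1 h3
  have h6 := abs_le.1 h4
  have h7 : z x * (a x * z' x + (a' x - b x) * z x) -
        2⁻¹ * (a' x * z x ^ 2 + a x * (2 * z x * z' x)) = (2⁻¹ * a' x - b x) * (z x * z x) := by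
    ring
  rw [h7]
  refine mul_le_mul_of_nonneg_right ?_ (mul_self_nonneg _)
  have := hC.nonneg
  linarith [h6.2, h5.1]

end Transport

/-! ### Calculus of C^{1,2} functions -/

section Parabolic

/-- `φ` is of class `C¹` in time and `C²` in space on the whole plane, with the given
derivatives. -/
structure IsC12 (φ φt φx φxx : ℝ → ℝ → ℝ) : Prop where
  cont : Continuous (Function.uncurry φ)
  cont_t : Continuous (Function.uncurry φt)
  cont_x : Continuous (Function.uncurry φx)
  cont_xx : Continuous (Function.uncurry φxx)
  deriv_t : ∀ t x, HasDerivAt (fun s => φ s x) (φt t x) t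
  deriv_x : ∀ t x, HasDerivAt (fun z => φ t z) (φx t x) x
  deriv_xx : ∀ t x, HasDerivAt (fun z => φx t z) (φxx t x) x

variable {φ φt φx φxx ψ ψt ψx ψxx : ℝ → ℝ → ℝ}

/-- Every test function used is a product: cutoff times sine mode in the estimates, cutoff times
approximate adjoint solution in the duality argument. -/
lemma IsC12.mul (h₁ : IsC12 φ φt φx φxx) (h₂ : IsC12 ψ ψt ψx ψxx) :
    IsC12 (fun t x => φ t x * ψ t x) (fun t x => φt t x * ψ t x + φ t x * ψt t x)
      (fun t x => φx t x * ψ t x + φ t x * ψx t x)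
      (fun t x => φxx t x * ψ t x + 2 * (φx t x * ψx t x) + φ t x * ψxx t x) where
  cont := h₁.cont.mul h₂.cont
  cont_t := (h₁.cont_t.mul h₂.cont).add (h₁.cont.mul h₂.cont_t)
  cont_x := (h₁.cont_x.mul h₂.cont).add (h₁.cont.mul h₂.cont_x)
  cont_xx := ((h₁.cont_xx.mul h₂.cont).add ((h₁.cont_x.mul h₂.cont_x).const_mul 2)).add
    (h₁.cont.mul h₂.cont_xx)
  deriv_t t x := (h₁.deriv_t t x).mul (h₂.deriv_t t x)
  deriv_x t x := (h₁.deriv_x t x).mul (h₂.deriv_x t x)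
  deriv_xx t x := by
    refine (((h₁.deriv_xx t x).mul (h₂.deriv_x t x)).add
      ((h₁.deriv_x t x).mul (h₂.deriv_xx t x))).congr_deriv ?_
    ring

lemma IsC12.of_space {f f' f'' : ℝ → ℝ} (h₁ : ∀ x, HasDerivAt f (f' x) x)
    (h₂ : ∀ x, HasDerivAt f' (f'' x) x) (h₃ : Continuous f'') :
    IsC12 (fun _ x => f x) (fun _ _ => 0) (fun _ x => f' x) (fun _ x => f'' x) where
  cont := (continuous_iff_continuousAt.2 fun x => (h₁ x).continuousAt).comp continuous_snd
  cont_t := continuous_const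
  cont_x := (continuous_iff_continuousAt.2 fun x => (h₂ x).continuousAt).comp continuous_snd
  cont_xx := h₃.comp continuous_snd
  deriv_t t x := hasDerivAt_const t (f x)
  deriv_x _ x := h₁ x
  deriv_xx _ x := h₂ x

lemma IsC12.isTestFunction {L : ℝ} (h : IsC12 φ φt φx φxx) {τ : ℝ}
    (h₀ : ∀ t ∈ Icc 0 τ, φ t 0 = 0) (h₁ : ∀ t ∈ Icc 0 τ, φ t L = 0) :
    IsTestFunction L τ φ φt φx φxx where
  cont := h.cont.continuousOn
  cont_t := h.cont_t.continuousOn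
  cont_x := h.cont_x.continuousOn
  cont_xx := h.cont_xx.continuousOn
  deriv_t t _ x _ := (h.deriv_t t x).hasDerivWithinAt
  deriv_x t _ x _ := (h.deriv_x t x).hasDerivWithinAt
  deriv_xx t _ x _ := (h.deriv_xx t x).hasDerivWithinAt
  zero_left := h₀
  zero_right := h₁

lemma isC12_mode {L : ℝ} (k : ℕ) : IsC12 (fun _ x => mode L k x) (fun _ _ => 0)
    (fun _ x => dmode L k x) (fun _ x => -(freq L k ^ 2 * mode L k x)) :=
  IsC12.of_space (hasDerivAt_mode k) (hasDerivAt_dmode k)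
    (continuous_const.mul (continuous_mode k)).neg

end Parabolic

/-! ### Multiplication operators on L² -/

section Multiplication

variable {ℓ : ℝ} {g : ℝ → ℝ}

/-- The product of a function and an element of `L²(0,ℓ)`. -/
def mulL2 (g : ℝ → ℝ) (u : L2 ℓ) : L2 ℓ := toL2 ℓ fun x => g x * u x

lemma memLp_mul_L2 (hg : MemLp g ⊤ (volume.restrict (Ioo 0 ℓ))) (u : L2 ℓ) :
    MemLp (fun x => g x * u x) 2 (volume.restrict (Ioo 0 ℓ)) := memLp_top_mul hg (Lp.memLp u)

lemma coeFn_mulL2 (hg : MemLp g ⊤ (volume.restrict (Ioo 0 ℓ))) (u : L2 ℓ) :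
    mulL2 g u =ᵐ[volume.restrict (Ioo 0 ℓ)] fun x => g x * u x := coeFn_toL2 (memLp_mul_L2 hg u)

lemma inner_mulL2 (hg : MemLp g ⊤ (volume.restrict (Ioo 0 ℓ))) (u : L2 ℓ) {f : ℝ → ℝ}
    (hf : MemLp f 2 (volume.restrict (Ioo 0 ℓ))) :
    inner ℝ (mulL2 g u) (toL2 ℓ f) = ∫ x in Ioo 0 ℓ, u x * (g x * f x) := by
  rw [inner_toL2 _ hf]
  refine integral_congr_ae ?_
  filter_upwards [coeFn_mulL2 hg u] with x hx
  rw [hx]; ring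

lemma mulL2_one (u : L2 ℓ) : mulL2 (fun _ => 1) u = u := by
  simp only [mulL2, one_mul]; exact toL2_coeFn u

lemma mulL2_zero (u : L2 ℓ) : mulL2 (fun _ => 0) u = 0 := by
  have := toL2_const_mul 0 (Lp.memLp u)
  simpa [mulL2] using this

lemma norm_mulL2_le {M : ℝ} (hg : ContinuousOn g (Icc 0 ℓ)) (hM : ∀ x ∈ Icc 0 ℓ, |g x| ≤ M)
    (u : L2 ℓ) : ‖mulL2 g u‖ ≤ M * ‖u‖ := by
  refine norm_toL2_le_of_ae_le (memLp_mul_L2 (memLp_of_continuousOn hg) u) ?_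
  filter_upwards [ae_restrict_mem measurableSet_Ioo] with x hx
  rw [abs_mul]
  exact mul_le_mul_of_nonneg_right (hM x (Ioo_subset_Icc_self hx)) (abs_nonneg _)

lemma mulL2_sub_left {g₁ g₂ : ℝ → ℝ} (hg₁ : MemLp g₁ ⊤ (volume.restrict (Ioo 0 ℓ)))
    (hg₂ : MemLp g₂ ⊤ (volume.restrict (Ioo 0 ℓ))) (u : L2 ℓ) :
    mulL2 (fun x => g₁ x - g₂ x) u = mulL2 g₁ u - mulL2 g₂ u := by
  refine Lp.ext ?_
  have h3 : mulL2 (fun x => g₁ x - g₂ x) u =ᵐ[volume.restrict (Ioo 0 ℓ)]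
    fun x => (g₁ x - g₂ x) * u x := coeFn_mulL2 (hg₁.sub hg₂) u
  filter_upwards [coeFn_mulL2 hg₁ u, coeFn_mulL2 hg₂ u, h3,
    Lp.coeFn_sub (mulL2 g₁ u) (mulL2 g₂ u)] with x h1 h2 h3 h4
  rw [h4, Pi.sub_apply, h1, h2, h3]; ring

lemma mulL2_sub_right (hg : MemLp g ⊤ (volume.restrict (Ioo 0 ℓ))) (u v : L2 ℓ) :
    mulL2 g (u - v) = mulL2 g u - mulL2 g v := by
  refine Lp.ext ?_
  filter_upwards [coeFn_mulL2 hg u, coeFn_mulL2 hg v, coeFn_mulL2 hg (u - v), Lp.coeFn_sub u v,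
    Lp.coeFn_sub (mulL2 g u) (mulL2 g v)] with x h1 h2 h3 h4 h5
  rw [h5, Pi.sub_apply, h1, h2, h3, h4, Pi.sub_apply]; ring

lemma memLp_slice {G : ℝ → ℝ → ℝ} (hG : Continuous (Function.uncurry G)) (t : ℝ) (p : ℝ≥0∞) :
    MemLp (G t) p (volume.restrict (Ioo 0 ℓ)) :=
  memLp_of_continuousOn (by fun_prop : Continuous (G t)).continuousOn

/-- By compactness of [0, ℓ], the slices `G s` converge to `G t` uniformly there as s → t, so they
act continuously on L². -/
lemma continuous_mulL2 {G : ℝ → ℝ → ℝ} (hG : Continuous (Function.uncurry G)) {y : ℝ → L2 ℓ}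
    (hy : Continuous y) : Continuous fun t => mulL2 (G t) (y t) := by
  have hGt : ∀ t, Continuous (G t) := fun t => by fun_prop
  refine continuous_iff_continuousAt.2 fun t => Metric.continuousAt_iff'.2 fun η hη => ?_
  obtain ⟨M, hM⟩ := isCompact_Icc.exists_bound_of_continuousOn ((hGt t).continuousOn (s := Icc 0 ℓ))
  set δ : ℝ := η / (2 * (‖y t‖ + 1)) with hδ
  have hδ0 : 0 < δ := by positivity
  have h1 : ∀ᶠ s in 𝓝 t, ∀ x ∈ Icc 0 ℓ, |G s x - G t x| < δ := by
    refine isCompact_Icc.eventually_forall_of_forall_eventually fun x _ => ?_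
    have hc : Continuous fun z : ℝ × ℝ => |G z.1 z.2 - G t z.2| := by fun_prop
    exact hc.continuousAt.eventually_lt continuousAt_const (by simpa using hδ0)
  have h2 : ∀ᶠ s in 𝓝 t, ‖y s - y t‖ < η / (2 * (|M| + δ + 1)) := by
    have := Metric.continuousAt_iff'.1 (hy.continuousAt (x := t)) (η / (2 * (|M| + δ + 1))) (by positivity)
    simpa [dist_eq_norm] using this
  filter_upwards [h1, h2] with s hs1 hs2
  rw [dist_eq_norm]
  have e1 : mulL2 (G s) (y s) - mulL2 (G t) (y t) =
      mulL2 (G s) (y s - y t) + mulL2 (fun x => G s x - G t x) (y t) := by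
    rw [mulL2_sub_left (memLp_slice hG s ⊤) (memLp_slice hG t ⊤),
      mulL2_sub_right (memLp_slice hG s ⊤)]
    abel
  have e2 : ‖mulL2 (G s) (y s - y t)‖ ≤ (|M| + δ) * ‖y s - y t‖ := by
    refine norm_mulL2_le (hGt s).continuousOn (fun x hx => ?_) _
    have h3 := hM x hx
    rw [Real.norm_eq_abs] at h3
    have h4 := abs_add_le (G t x) (G s x - G t x)
    rw [add_sub_cancel] at h4
    linarith [hs1 x hx, le_abs_self M]
  have e3 : ‖mulL2 (fun x => G s x - G t x) (y t)‖ ≤ δ * ‖y t‖ :=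
    norm_mulL2_le ((hGt s).sub (hGt t)).continuousOn (fun x hx => (hs1 x hx).le) _
  have e4 : (|M| + δ) * ‖y s - y t‖ < η / 2 := by
    rw [lt_div_iff₀ (by positivity)] at hs2
    nlinarith [norm_nonneg (y s - y t)]
  have e5 : δ * ‖y t‖ ≤ η / 2 := by
    rw [hδ, div_mul_eq_mul_div, div_le_div_iff₀ (by positivity) (by positivity)]
    nlinarith [norm_nonneg (y t)]
  rw [e1]
  linarith [norm_add_le (mulL2 (G s) (y s - y t)) (mulL2 (fun x => G s x - G t x) (y t))]

end Multiplication

/-! ### Differential equations for the sine coefficients -/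

section ModeEquation

variable {a b : ℝ → ℝ} {L T ε : ℝ} {y₀ : L2 L} {h : L2 T} {y : ℝ → L2 L}
  {χ χt χx χxx : ℝ → ℝ → ℝ}

lemma integral_add_four {α : Type*} [MeasurableSpace α] {μ : Measure α} {f₁ f₂ f₃ f₄ : α → ℝ}
    (h₁ : Integrable f₁ μ) (h₂ : Integrable f₂ μ) (h₃ : Integrable f₃ μ) (h₄ : Integrable f₄ μ) :
    ∫ x, f₁ x ∂μ + ∫ x, f₂ x ∂μ + ∫ x, f₃ x ∂μ + ∫ x, f₄ x ∂μ =
      ∫ x, (f₁ x + f₂ x + f₃ x + f₄ x) ∂μ := by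
  have h12 : Integrable (fun x => f₁ x + f₂ x) μ := h₁.add h₂
  have h123 : Integrable (fun x => f₁ x + f₂ x + f₃ x) μ := h12.add h₃
  rw [integral_add h123 h₄, integral_add h12 h₃, integral_add h₁ h₂]

/-- The equation satisfied by the sine coefficients of `χ y` when `χ` is transported by `a`. -/
lemma IsSolution.mode_equation (hL : 0 < L) (ha : ContDiffOn ℝ 1 a (Icc 0 L))
    (hb : MemLp b ⊤ (volume.restrict (Ioo 0 L))) (hsol : IsSolution a b L T ε y₀ h y)
    (hχ : IsC12 χ χt χx χxx)
    (htr : ∀ t ∈ Icc 0 T, ∀ x ∈ Icc 0 L, χt t x + a x * χx t x = 0) (k : ℕ) {τ : ℝ}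
    (hτ : τ ∈ Icc 0 T) :
    inner ℝ (mulL2 (χ τ) (y τ)) (toL2 L (mode L k)) =
      inner ℝ (mulL2 (χ 0) y₀) (toL2 L (mode L k)) +
      (∫ t in (0:ℝ)..τ, (-(ε * freq L k ^ 2 * inner ℝ (mulL2 (χ t) (y t)) (toL2 L (mode L k))) +
        inner ℝ (mulL2 (χ t) (y t)) (toL2 L (transportMode a b L k)) +
        inner ℝ (ε • mulL2 (χxx t) (y t)) (toL2 L (mode L k)) +
        inner ℝ ((2 * ε) • mulL2 (χx t) (y t)) (toL2 L (dmode L k)))) +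
      ε * ∫ t in (0:ℝ)..τ, h t * (χ t 0 * dmode L k 0) := by
  have hmχ := fun t => memLp_slice (ℓ := L) hχ.cont t ⊤
  have hmx := fun t => memLp_slice (ℓ := L) hχ.cont_x t ⊤
  have hmxx := fun t => memLp_slice (ℓ := L) hχ.cont_xx t ⊤
  -- The sine factor vanishes at both ends, so χ times a mode is admissible with no support
  -- condition on χ. The derivatives of χ falling on the mode produce the sources 2ε χ_x and ε χ_xx;
  -- the transport hypothesis cancels χ_t + a χ_x.
  have htest := (hχ.mul (isC12_mode (L := L) k)).isTestFunction (L := L) (τ := τ)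
    (fun t _ => by simp [mode_zero]) (fun t _ => by simp [mode_right hL])
  have key := hsol.transposition τ hτ _ _ _ _ htest
  have hm1 := memLp_mode (L := L) (p := 2) k
  have hm2 := memLp_dmode (L := L) (p := 2) k
  have hm3 := memLp_transportMode hL ha hb k
  rw [← inner_mulL2 (hmχ τ) (y τ) hm1, ← inner_mulL2 (hmχ 0) y₀ hm1,
    integral_Ioo_eq_intervalIntegral hτ.1, integral_Ioo_eq_intervalIntegral hτ.1] at key
  have hin : ∫ t in (0:ℝ)..τ, (-(ε * freq L k ^ 2 *
        inner ℝ (mulL2 (χ t) (y t)) (toL2 L (mode L k))) +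
        inner ℝ (mulL2 (χ t) (y t)) (toL2 L (transportMode a b L k)) +
        inner ℝ (ε • mulL2 (χxx t) (y t)) (toL2 L (mode L k)) +
        inner ℝ ((2 * ε) • mulL2 (χx t) (y t)) (toL2 L (dmode L k))) =
      ∫ t in (0:ℝ)..τ, ∫ x in Ioo 0 L, y t x * adjointExpr a b L ε
        (fun t x => χ t x * mode L k x) (fun t x => χt t x * mode L k x + χ t x * 0)
        (fun t x => χx t x * mode L k x + χ t x * dmode L k x)
        (fun t x => χxx t x * mode L k x + 2 * (χx t x * dmode L k x) +
          χ t x * -(freq L k ^ 2 * mode L k x)) t x := by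
    refine intervalIntegral.integral_congr fun t ht => ?_
    rw [uIcc_of_le hτ.1] at ht
    have i0 : ∀ {g f : ℝ → ℝ}, MemLp g ⊤ (volume.restrict (Ioo 0 L)) →
        MemLp f 2 (volume.restrict (Ioo 0 L)) →
        Integrable (fun x => y t x * (g x * f x)) (volume.restrict (Ioo 0 L)) := fun hg hf =>
      (Lp.memLp (y t)).integrable_mul (memLp_top_mul hg hf)
    have i1 := (i0 (hmχ t) hm1).const_mul (-(ε * freq L k ^ 2))
    have i2 := i0 (hmχ t) hm3
    have i3 := (i0 (hmxx t) hm1).const_mul ε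
    have i4 := (i0 (hmx t) hm2).const_mul (2 * ε)
    have e : -(ε * freq L k ^ 2 * ∫ x in Ioo 0 L, y t x * (χ t x * mode L k x)) =
        ∫ x in Ioo 0 L, -(ε * freq L k ^ 2) * (y t x * (χ t x * mode L k x)) := by
      rw [integral_const_mul]; ring
    simp only [inner_smul_left, conj_trivial]
    rw [inner_mulL2 (hmχ t) _ hm1, inner_mulL2 (hmχ t) _ hm3, inner_mulL2 (hmxx t) _ hm1,
      inner_mulL2 (hmx t) _ hm2, e, ← integral_const_mul, ← integral_const_mul,
      integral_add_four i1 i2 i3 i4]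
    refine setIntegral_congr_fun measurableSet_Ioo fun x hx => ?_
    have htx := htr t ⟨ht.1, ht.2.trans hτ.2⟩ x (Ioo_subset_Icc_self hx)
    simp only [adjointExpr, transportMode]
    linear_combination (-(y t x * mode L k x)) * htx
  have hbd : ∀ t, χx t 0 * mode L k 0 + χ t 0 * dmode L k 0 = χ t 0 * dmode L k 0 := by
    intro t; rw [mode_zero]; ring
  simp only [hbd] at key
  rw [hin]
  linear_combination key

/-- A solution may be extended continuously to all times. -/
lemma IsSolution.exists_continuous (hT : 0 ≤ T) (hsol : IsSolution a b L T ε y₀ h y) :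
    ∃ y' : ℝ → L2 L, Continuous y' ∧ IsSolution a b L T ε y₀ h y' ∧ y' T = y T := by
  obtain ⟨y', hc, heq⟩ : ∃ y' : ℝ → L2 L, Continuous y' ∧ ∀ t ∈ Icc 0 T, y' t = y t :=
    ⟨_, (continuousOn_iff_continuous_domRestrict.1 hsol.cont).Icc_extend' (h := hT),
      fun t ht => IccExtend_of_mem hT _ ht⟩
  refine ⟨y', hc, ⟨hc.continuousOn, fun τ hτ φ φt φx φxx hφ => ?_⟩, heq T ⟨hT, le_rfl⟩⟩
  have key := hsol.transposition τ hτ φ φt φx φxx hφ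
  have h1 : ∫ t in Ioo 0 τ, ∫ x in Ioo 0 L, y' t x * adjointExpr a b L ε φ φt φx φxx t x =
      ∫ t in Ioo 0 τ, ∫ x in Ioo 0 L, y t x * adjointExpr a b L ε φ φt φx φxx t x := by
    refine setIntegral_congr_fun measurableSet_Ioo fun t ht => ?_
    simp only [heq t ⟨ht.1.le, ht.2.le.trans hτ.2⟩]
  rw [h1, heq τ hτ]
  exact key

end ModeEquation

/-! ### Global and localised bounds on solutions -/

section Estimates

variable {a b : ℝ → ℝ} {L T ε C : ℝ} {y₀ : L2 L} {h : L2 T} {y : ℝ → L2 L}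

/-- Dominated convergence, with ‖v - Pv‖ ≤ 2‖v‖. In the energy estimates this tail is multiplied by
1/ε, but it vanishes as N → ∞ with ε fixed. -/
lemma tendsto_integral_sub_proj (hL : 0 < L) (T : ℝ) {v : ℝ → L2 L} (hv : Continuous v) :
    Tendsto (fun N => ∫ t in (0:ℝ)..T, ‖v t - proj L N (v t)‖ ^ 2) atTop (𝓝 0) := by
  suffices H : Tendsto (fun N => ∫ t in (0:ℝ)..T, ‖v t - proj L N (v t)‖ ^ 2) atTop
      (𝓝 (∫ _ in (0:ℝ)..T, (0:ℝ))) by rwa [intervalIntegral.integral_zero] at H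
  refine intervalIntegral.tendsto_integral_filter_of_dominated_convergence
    (fun t => (2 * ‖v t‖) ^ 2) (Eventually.of_forall fun N => ?_) (Eventually.of_forall fun N => ?_)
    (Continuous.intervalIntegrable (by fun_prop) _ _) (Eventually.of_forall fun t _ => ?_)
  · have := continuous_proj (L := L) N
    exact (by fun_prop : Continuous fun t => ‖v t - proj L N (v t)‖ ^ 2).aestronglyMeasurable
  · refine Eventually.of_forall fun t _ => ?_
    rw [Real.norm_of_nonneg (by positivity)]
    exact pow_le_pow_left₀ (norm_nonneg _) (norm_sub_proj_le hL N _) 2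
  · have h1 : Tendsto (fun N => v t - proj L N (v t)) atTop (𝓝 (v t - v t)) :=
      tendsto_const_nhds.sub (tendsto_proj hL (v t))
    simpa using h1.norm.pow 2

lemma intervalIntegrable_coeFn (hT : 0 ≤ T) (h : L2 T) : IntervalIntegrable h volume 0 T := by
  rw [intervalIntegrable_iff_integrableOn_Ioo_of_le hT]
  exact (Lp.memLp h).integrable one_le_two

lemma intervalIntegrable_coeFn_sq (hT : 0 ≤ T) (h : L2 T) :
    IntervalIntegrable (fun t => h t ^ 2) volume 0 T := by
  rw [intervalIntegrable_iff_integrableOn_Ioo_of_le hT]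
  exact (Lp.memLp h).integrable_sq

lemma integral_coeFn_sq (hT : 0 ≤ T) (h : L2 T) : ∫ t in (0:ℝ)..T, h t ^ 2 = ‖h‖ ^ 2 := by
  rw [← integral_Ioo_eq_intervalIntegral hT, ← real_inner_self_eq_norm_sq, inner_eq_integral]
  simp only [sq]

lemma summable_inv_freq_sq (L : ℝ) : Summable fun k => 2 / L / freq L k ^ 2 := by
  have h1 : Summable fun k : ℕ => 1 / ((k : ℝ) + 1) ^ 2 := by
    have := (summable_nat_add_iff 1).2 (Real.summable_one_div_nat_pow.2 (one_lt_two))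
    simpa using this
  refine (h1.mul_left (2 / L / (Real.pi / L) ^ 2)).congr fun k => ?_
  rw [freq, mul_pow, div_mul_div_comm, mul_one, mul_comm ((Real.pi / L) ^ 2), div_div]

/-- The part of a solution generated by the boundary control, in the heat flow. -/
lemma exists_boundary_modes (hL : 0 < L) (hT : 0 ≤ T) (hε : 0 < ε) (h : L2 T) :
    ∃ w : ℕ → ℝ → ℝ, (∀ k, Continuous (w k)) ∧
      (∀ k, ∀ τ ∈ Icc 0 T, w k τ = ε * (∫ t in (0:ℝ)..τ, h t * dmode L k 0) -
        ∫ t in (0:ℝ)..τ, ε * freq L k ^ 2 * w k t) ∧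
      ∀ N, ∫ t in (0:ℝ)..T, ∑ k ∈ Finset.range N, w k t ^ 2 ≤
        (∑' k, 2 / L / freq L k ^ 2) * ‖h‖ ^ 2 := by
  have hl : ∀ k, 0 < ε * freq L k ^ 2 := fun k => by have := freq_pos hL k; positivity
  choose u huc hu hub using fun k => exists_relaxation (hl k) hT (intervalIntegrable_coeFn hT h)
    (intervalIntegrable_coeFn_sq hT h)
  refine ⟨fun k t => ε * dmode L k 0 * u k t, fun k => (huc k).const_mul _, fun k τ hτ => ?_,
    fun N => ?_⟩
  · have h1 : ∀ t, ε * freq L k ^ 2 * (ε * dmode L k 0 * u k t) =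
      ε * dmode L k 0 * (ε * freq L k ^ 2 * u k t) := fun t => by ring
    simp only [h1]
    rw [intervalIntegral.integral_mul_const, intervalIntegral.integral_const_mul, hu k τ hτ,
      intervalIntegral.integral_sub]
    · ring
    · exact (intervalIntegrable_coeFn hT h).mono_set
        (by rw [uIcc_of_le hτ.1, uIcc_of_le hT]; exact Icc_subset_Icc_right hτ.2)
    · exact ((huc k).const_mul _).intervalIntegrable _ _
  · have hi : ∀ k ∈ Finset.range N,
        IntervalIntegrable (fun t => (ε * dmode L k 0 * u k t) ^ 2) volume 0 T := fun k _ =>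
      (((huc k).const_mul _).pow 2).intervalIntegrable _ _
    change ∫ t in (0:ℝ)..T, ∑ k ∈ Finset.range N, (ε * dmode L k 0 * u k t) ^ 2 ≤ _
    rw [intervalIntegral.integral_finsetSum hi]
    have hle : ∀ k, ∫ t in (0:ℝ)..T, (ε * dmode L k 0 * u k t) ^ 2 ≤
        2 / L / freq L k ^ 2 * ‖h‖ ^ 2 := by
      intro k
      have hk := hub k
      rw [integral_coeFn_sq hT] at hk
      have hf := freq_pos hL k
      -- The forcing amplitude and the relaxation rate both scale like ε, so ε cancels and what
      -- remains is summable in k, of order 1/k².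
      have h2 : (ε * dmode L k 0) ^ 2 = 2 / L / freq L k ^ 2 * (ε * freq L k ^ 2) ^ 2 := by
        have h3 : √(2 / L) ^ 2 = 2 / L := Real.sq_sqrt (by positivity)
        simp only [dmode, mul_zero, Real.cos_zero, mul_one, mul_pow, h3]
        field_simp
      simp only [mul_pow _ (u k _)]
      rw [intervalIntegral.integral_const_mul, h2, mul_assoc]
      exact mul_le_mul_of_nonneg_left hk (by positivity)
    refine (Finset.sum_le_sum fun k _ => hle k).trans ?_
    rw [← Finset.sum_mul]
    refine mul_le_mul_of_nonneg_right ?_ (by positivity)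
    exact (summable_inv_freq_sq L).sum_le_tsum _ fun k _ => by positivity

lemma isC12_one : IsC12 (fun _ _ => 1) (fun _ _ => 0) (fun _ _ => 0) (fun _ _ => 0) :=
  IsC12.of_space (f := fun _ => 1) (f' := fun _ => 0) (f'' := fun _ => 0)
    (fun x => hasDerivAt_const x 1) (fun x => hasDerivAt_const x 0) continuous_const

lemma norm_sq_sum_mode (hL : 0 < L) (N : ℕ) (c : ℕ → ℝ) :
    ‖∑ k ∈ Finset.range N, c k • toL2 L (mode L k)‖ ^ 2 = ∑ k ∈ Finset.range N, c k ^ 2 := by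
  rw [← real_inner_self_eq_norm_sq, (orthonormal_mode hL).inner_sum]
  simp [sq]

lemma add_sq_le_two_mul {E : Type*} [SeminormedAddCommGroup E] (u v : E) :
    ‖u + v‖ ^ 2 ≤ 2 * ‖u‖ ^ 2 + 2 * ‖v‖ ^ 2 := by
  have := norm_add_le u v
  nlinarith [norm_nonneg (u + v), sq_nonneg (‖u‖ - ‖v‖)]

/-- A global bound for solutions in `L²((0,T) × (0,L))`, degenerating as `ε → 0`. -/
lemma exists_global_bound (hL : 0 < L) (hT : 0 ≤ T) (ha : ContDiffOn ℝ 1 a (Icc 0 L))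
    (hb : MemLp b ⊤ (volume.restrict (Ioo 0 L))) :
    ∃ K, 0 ≤ K ∧ ∀ ε, 0 < ε → ε ≤ 1 → ∀ (y₀ : L2 L) (h : L2 T) (y : ℝ → L2 L), Continuous y →
      IsSolution a b L T ε y₀ h y → ε * ∫ t in (0:ℝ)..T, ‖y t‖ ^ 2 ≤ K * (‖y₀‖ ^ 2 + ‖h‖ ^ 2) := by
  obtain ⟨C, hC⟩ := exists_coeffBound hL ha hb
  have hC0 := hC.nonneg
  set W : ℝ := ∑' k, 2 / L / freq L k ^ 2 with hW
  have hW0 : 0 ≤ W := tsum_nonneg fun k => by positivity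
  set G : ℝ := Real.exp ((2 * (2 * C) + 2) * T) with hG
  refine ⟨4 * (T * G) * (1 + 24 * C ^ 2 * W) + 4 * W, by positivity,
    fun ε hε hε1 y₀ h y hy hsol => ?_⟩
  obtain ⟨w, hwc, hweq, hwb⟩ := exists_boundary_modes hL hT hε h
  -- The control enters mode k with amplitude proportional to its frequency, which no L² source
  -- represents. Subtracting the heat modes `w` removes it from the system.
  set Z : ℕ → ℝ → ℝ := fun k t => inner ℝ (y t) (toL2 L (mode L k)) - w k t with hZ
  have hZc : ∀ k, Continuous (Z k) := fun k => by
    have := hwc k; fun_prop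
  have hw0 : ∀ k, w k 0 = 0 := fun k => by
    rw [hweq k 0 ⟨le_rfl, hT⟩]; simp
  -- The cutoff χ = 1 gives the equations for y itself.
  have hmode := fun k τ hτ => hsol.mode_equation (τ := τ) hL ha hb isC12_one
    (fun t _ x _ => by simp) k hτ
  simp only [mulL2_one, mulL2_zero, smul_zero, inner_zero_left, add_zero, one_mul] at hmode
  have hy00 : ∀ k, inner ℝ (y 0) (toL2 L (mode L k)) = inner ℝ y₀ (toL2 L (mode L k)) := fun k => by
    rw [hmode k 0 ⟨le_rfl, hT⟩]; simp
  have hZeq : ∀ k, ∀ τ ∈ Icc 0 T, Z k τ = Z k 0 + ∫ t in (0:ℝ)..τ,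
      (-(ε * freq L k ^ 2 * Z k t) + inner ℝ (y t) (toL2 L (transportMode a b L k)) +
        inner ℝ (0 : L2 L) (toL2 L (mode L k)) + inner ℝ (0 : L2 L) (toL2 L (dmode L k))) := by
    intro k τ hτ
    have h1 := hmode k τ hτ
    have h2 := hweq k τ hτ
    have h3 : ∫ t in (0:ℝ)..τ, (-(ε * freq L k ^ 2 * Z k t) +
        inner ℝ (y t) (toL2 L (transportMode a b L k)) +
        inner ℝ (0 : L2 L) (toL2 L (mode L k)) + inner ℝ (0 : L2 L) (toL2 L (dmode L k))) =
        (∫ t in (0:ℝ)..τ, (-(ε * freq L k ^ 2 * inner ℝ (y t) (toL2 L (mode L k))) +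
          inner ℝ (y t) (toL2 L (transportMode a b L k)))) +
        ∫ t in (0:ℝ)..τ, ε * freq L k ^ 2 * w k t := by
      rw [← intervalIntegral.integral_add]
      · refine intervalIntegral.integral_congr fun t _ => ?_
        simp only [hZ, inner_zero_left]; ring
      · exact Continuous.intervalIntegrable (by fun_prop) _ _
      · exact Continuous.intervalIntegrable ((hwc k).const_mul _) _ _
    rw [h3]
    simp only [hZ, hy00, hw0]
    linear_combination h1 - h2
  set z : ℕ → ℝ → L2 L := fun N t => ∑ k ∈ Finset.range N, Z k t • toL2 L (mode L k) with hz
  set ω : ℕ → ℝ → L2 L := fun N t => ∑ k ∈ Finset.range N, w k t • toL2 L (mode L k) with hω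
  have hzω : ∀ N t, z N t + ω N t = proj L N (y t) := by
    intro N t
    simp only [hz, hω, proj, ← Finset.sum_add_distrib, ← add_smul, hZ, sub_add_cancel]
  have hzc : ∀ N, Continuous (z N) := fun N => by fun_prop
  have hωc : ∀ N, Continuous (ω N) := fun N => by fun_prop
  have hpc := fun N => continuous_proj (L := L) N
  have hωb : ∀ N, ∫ t in (0:ℝ)..T, ‖ω N t‖ ^ 2 ≤ W * ‖h‖ ^ 2 := by
    intro N
    simp only [hω, norm_sq_sum_mode hL]
    exact hwb N
  set R : ℕ → ℝ := fun N => ∫ t in (0:ℝ)..T, ‖y t - proj L N (y t)‖ ^ 2 with hR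
  have hRt : Tendsto R atTop (𝓝 0) := tendsto_integral_sub_proj hL T hy
  have hz0 : ∀ N, ‖z N 0‖ ^ 2 ≤ ‖y₀‖ ^ 2 := by
    intro N
    have : z N 0 = proj L N y₀ := by simp only [hz, hZ, hw0, hy00, sub_zero, proj]
    rw [this]
    exact pow_le_pow_left₀ (norm_nonneg _) (norm_proj_le hL N _) 2
  -- Here y - z is the spectral tail plus the heat flow of the control. The latter persists as N → ∞
  -- and, divided by ε in the energy estimate, is the cause of the degeneration.
  have hyz : ∀ N, ∫ t in (0:ℝ)..T, ‖y t - z N t‖ ^ 2 ≤ 2 * R N + 2 * (W * ‖h‖ ^ 2) := by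
    intro N
    have h1 : ∫ t in (0:ℝ)..T, ‖y t - z N t‖ ^ 2 ≤
        ∫ t in (0:ℝ)..T, (2 * ‖y t - proj L N (y t)‖ ^ 2 + 2 * ‖ω N t‖ ^ 2) := by
      refine intervalIntegral.integral_mono_on hT (Continuous.intervalIntegrable (by fun_prop) _ _)
        (Continuous.intervalIntegrable (by fun_prop) _ _) fun t _ => ?_
      have h2 : y t - z N t = (y t - proj L N (y t)) + ω N t := by rw [← hzω]; abel
      rw [h2]
      exact add_sq_le_two_mul _ _
    rw [intervalIntegral.integral_add (Continuous.intervalIntegrable (by fun_prop) _ _)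
      (Continuous.intervalIntegrable (by fun_prop) _ _), intervalIntegral.integral_const_mul,
      intervalIntegral.integral_const_mul] at h1
    linarith [hωb N]
  have hzb : ∀ N, ∀ τ ∈ Icc 0 T, ‖z N τ‖ ^ 2 ≤
      G * (‖y₀‖ ^ 2 + 24 * C ^ 2 / ε * (R N + W * ‖h‖ ^ 2)) := by
    intro N τ hτ
    have := galerkin_energy (N := N) (by positivity) hε hε1 (orthonormal_mode hL)
      (norm_sq_dtrigSum hL N) (inner_transportSum_le hC hL ha hb N)
      (norm_transportSum_le hC hL ha hb N) hy (continuous_const (y := (0 : L2 L)))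
      (continuous_const (y := (0 : L2 L))) hZc (fun k _ => hZeq k) τ hτ
    refine this.trans (mul_le_mul_of_nonneg_left (add_le_add (hz0 N) ?_) (Real.exp_pos _).le)
    simp only [norm_zero, ne_eq, OfNat.ofNat_ne_zero, not_false_eq_true, zero_pow, mul_zero,
      add_zero]
    rw [intervalIntegral.integral_const_mul]
    have h1 := mul_le_mul_of_nonneg_left (hyz N)
      (by positivity : 0 ≤ 3 * (2 * C) ^ 2 / ε)
    refine h1.trans (le_of_eq ?_)
    ring
  have hfin : ∀ N, ∫ t in (0:ℝ)..T, ‖y t‖ ^ 2 ≤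
      4 * (T * (G * (‖y₀‖ ^ 2 + 24 * C ^ 2 / ε * (R N + W * ‖h‖ ^ 2)))) + 4 * (W * ‖h‖ ^ 2) +
        2 * R N := by
    intro N
    have hzN := hzb N
    generalize G * (‖y₀‖ ^ 2 + 24 * C ^ 2 / ε * (R N + W * ‖h‖ ^ 2)) = S at hzN ⊢
    have h1 : ∫ t in (0:ℝ)..T, ‖y t‖ ^ 2 ≤
        ∫ t in (0:ℝ)..T, ((4 * S + 4 * ‖ω N t‖ ^ 2) + 2 * ‖y t - proj L N (y t)‖ ^ 2) := by
      refine intervalIntegral.integral_mono_on hT (Continuous.intervalIntegrable (by fun_prop) _ _)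
        (Continuous.intervalIntegrable (by fun_prop) _ _) fun t ht => ?_
      have h2 := add_sq_le_two_mul (proj L N (y t)) (y t - proj L N (y t))
      have h3 := add_sq_le_two_mul (z N t) (ω N t)
      rw [add_sub_cancel] at h2
      rw [hzω] at h3
      linarith [hzN t ht]
    rw [intervalIntegral.integral_add (Continuous.intervalIntegrable (by fun_prop) _ _)
      (Continuous.intervalIntegrable (by fun_prop) _ _), intervalIntegral.integral_add
      (Continuous.intervalIntegrable (by fun_prop) _ _)
      (Continuous.intervalIntegrable (by fun_prop) _ _), intervalIntegral.integral_const_mul,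
      intervalIntegral.integral_const_mul, intervalIntegral.integral_const_mul,
      intervalIntegral.integral_const, smul_eq_mul, sub_zero] at h1
    have h2 : R N = ∫ t in (0:ℝ)..T, ‖y t - proj L N (y t)‖ ^ 2 := rfl
    rw [← h2] at h1
    linarith [hωb N]
  -- N → ∞ at fixed ε: the tail `R N` disappears, and the remaining 1/ε is absorbed by multiplying
  -- the bound by ε.
  have hlim : Tendsto (fun N => 4 * (T * (G * (‖y₀‖ ^ 2 + 24 * C ^ 2 / ε * (R N + W * ‖h‖ ^ 2)))) +
      4 * (W * ‖h‖ ^ 2) + 2 * R N) atTop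
      (𝓝 (4 * (T * (G * (‖y₀‖ ^ 2 + 24 * C ^ 2 / ε * (0 + W * ‖h‖ ^ 2)))) +
        4 * (W * ‖h‖ ^ 2) + 2 * 0)) :=
    (((((((hRt.add_const _).const_mul _).const_add _).const_mul _).const_mul _).const_mul _).add_const
      _).add (hRt.const_mul _)
  have h1 := ge_of_tendsto' hlim hfin
  have h2 := mul_le_mul_of_nonneg_left h1 hε.le
  refine h2.trans ?_
  have h3 : ε * (4 * (T * (G * (‖y₀‖ ^ 2 + 24 * C ^ 2 / ε * (0 + W * ‖h‖ ^ 2)))) +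
      4 * (W * ‖h‖ ^ 2) + 2 * 0) = 4 * (T * G) * (ε * ‖y₀‖ ^ 2) +
      4 * (T * G) * (24 * C ^ 2 * W) * ‖h‖ ^ 2 + 4 * W * (ε * ‖h‖ ^ 2) := by
    field_simp; ring
  rw [h3]
  have hG0 : 0 < G := Real.exp_pos _
  have h4 : ε * ‖y₀‖ ^ 2 ≤ ‖y₀‖ ^ 2 := mul_le_of_le_one_left (by positivity) hε1
  have h5 : ε * ‖h‖ ^ 2 ≤ ‖h‖ ^ 2 := mul_le_of_le_one_left (by positivity) hε1
  have h6 := mul_le_mul_of_nonneg_left h4 (by positivity : 0 ≤ 4 * (T * G))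
  have h7 := mul_le_mul_of_nonneg_left h5 (by positivity : 0 ≤ 4 * W)
  have h8 : 0 ≤ 4 * (T * G) * (24 * C ^ 2 * W) * ‖y₀‖ ^ 2 := by positivity
  have h9 : 0 ≤ 4 * W * ‖y₀‖ ^ 2 := by positivity
  have h10 : 0 ≤ 4 * (T * G) * ‖h‖ ^ 2 := by positivity
  linarith

lemma IsC12.exists_bound {χ χt χx χxx : ℝ → ℝ → ℝ} (hχ : IsC12 χ χt χx χxx) (L T : ℝ) :
    ∃ M, 0 ≤ M ∧ ∀ t ∈ Icc 0 T, ∀ x ∈ Icc 0 L, |χ t x| ≤ M ∧ |χx t x| ≤ M ∧ |χxx t x| ≤ M := by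
  have hK : IsCompact (Icc 0 T ×ˢ Icc 0 L) := isCompact_Icc.prod isCompact_Icc
  obtain ⟨M₁, h₁⟩ := hK.exists_bound_of_continuousOn hχ.cont.continuousOn
  obtain ⟨M₂, h₂⟩ := hK.exists_bound_of_continuousOn hχ.cont_x.continuousOn
  obtain ⟨M₃, h₃⟩ := hK.exists_bound_of_continuousOn hχ.cont_xx.continuousOn
  refine ⟨|M₁| + |M₂| + |M₃|, by positivity, fun t ht x hx => ⟨?_, ?_, ?_⟩⟩
  · have := h₁ (t, x) ⟨ht, hx⟩
    rw [Real.norm_eq_abs] at this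
    exact this.trans (by linarith [le_abs_self M₁, abs_nonneg M₂, abs_nonneg M₃])
  · have := h₂ (t, x) ⟨ht, hx⟩
    rw [Real.norm_eq_abs] at this
    exact this.trans (by linarith [le_abs_self M₂, abs_nonneg M₁, abs_nonneg M₃])
  · have := h₃ (t, x) ⟨ht, hx⟩
    rw [Real.norm_eq_abs] at this
    exact this.trans (by linarith [le_abs_self M₃, abs_nonneg M₁, abs_nonneg M₂])

/-- A bound, uniform in `ε`, for `χ y` when the cutoff `χ` is transported by `a`. -/
lemma exists_local_bound (hL : 0 < L) (hT : 0 ≤ T) (ha : ContDiffOn ℝ 1 a (Icc 0 L))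
    (hb : MemLp b ⊤ (volume.restrict (Ioo 0 L))) {χ χt χx χxx : ℝ → ℝ → ℝ}
    (hχ : IsC12 χ χt χx χxx) (htr : ∀ t ∈ Icc 0 T, ∀ x ∈ Icc 0 L, χt t x + a x * χx t x = 0)
    (hχ0 : ∀ t ∈ Icc 0 T, χ t 0 = 0) :
    ∃ K, 0 ≤ K ∧ ∀ ε, 0 < ε → ε ≤ 1 → ∀ (y₀ : L2 L) (h : L2 T) (y : ℝ → L2 L), Continuous y →
      IsSolution a b L T ε y₀ h y → ∀ τ ∈ Icc 0 T,
        ‖mulL2 (χ τ) (y τ)‖ ^ 2 ≤ K * (‖y₀‖ ^ 2 + ‖h‖ ^ 2) := by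
  obtain ⟨C, hC⟩ := exists_coeffBound hL ha hb
  have hC0 := hC.nonneg
  obtain ⟨M, hM0, hM⟩ := hχ.exists_bound L T
  obtain ⟨K₀, hK₀, hglob⟩ := exists_global_bound hL hT ha hb
  set G : ℝ := Real.exp ((2 * (2 * C) + 2) * T) with hG
  have hG0 : 0 < G := Real.exp_pos _
  refine ⟨G * (M ^ 2 + 5 * M ^ 2 * K₀), by positivity, fun ε hε hε1 y₀ h y hy hsol τ hτ => ?_⟩
  have hsl : ∀ {F : ℝ → ℝ → ℝ}, Continuous (Function.uncurry F) → ∀ t,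
      ContinuousOn (F t) (Icc 0 L) := fun hF t => (by fun_prop : Continuous _).continuousOn
  set v : ℝ → L2 L := fun t => mulL2 (χ t) (y t) with hv
  set g₀ : ℝ → L2 L := fun t => ε • mulL2 (χxx t) (y t) with hg₀
  set g₁ : ℝ → L2 L := fun t => (2 * ε) • mulL2 (χx t) (y t) with hg₁
  have hvc : Continuous v := continuous_mulL2 hχ.cont hy
  have hg₀c : Continuous g₀ := (continuous_mulL2 hχ.cont_xx hy).const_smul ε
  have hg₁c : Continuous g₁ := (continuous_mulL2 hχ.cont_x hy).const_smul (2 * ε)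
  have hmode := fun k τ hτ => hsol.mode_equation (τ := τ) hL ha hb hχ htr k hτ
  have hv0 : ∀ k, inner ℝ (v 0) (toL2 L (mode L k)) =
      inner ℝ (mulL2 (χ 0) y₀) (toL2 L (mode L k)) := fun k => by
    have := hmode k 0 ⟨le_rfl, hT⟩
    simpa using this
  have hZeq : ∀ k, ∀ τ ∈ Icc 0 T, inner ℝ (v τ) (toL2 L (mode L k)) =
      inner ℝ (v 0) (toL2 L (mode L k)) + ∫ t in (0:ℝ)..τ,
      (-(ε * freq L k ^ 2 * inner ℝ (v t) (toL2 L (mode L k))) +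
        inner ℝ (v t) (toL2 L (transportMode a b L k)) +
        inner ℝ (g₀ t) (toL2 L (mode L k)) + inner ℝ (g₁ t) (toL2 L (dmode L k))) := by
    intro k τ hτ
    have h1 := hmode k τ hτ
    -- The cutoff vanishes at x = 0, so the control is absent from these equations and no heat modes
    -- have to be subtracted: z is exactly the projection of χ y.
    have h2 : ∫ t in (0:ℝ)..τ, h t * (χ t 0 * dmode L k 0) = ∫ t in (0:ℝ)..τ, (0:ℝ) := by
      refine intervalIntegral.integral_congr fun t ht => ?_
      rw [uIcc_of_le hτ.1] at ht
      simp [hχ0 t ⟨ht.1, ht.2.trans hτ.2⟩]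
    rw [h2, intervalIntegral.integral_zero, mul_zero, add_zero] at h1
    rw [hv0]
    exact h1
  have hpv0 : ∀ N, ‖proj L N (v 0)‖ ^ 2 ≤ M ^ 2 * ‖y₀‖ ^ 2 := by
    intro N
    have h1 : proj L N (v 0) = proj L N (mulL2 (χ 0) y₀) := by simp only [proj, hv0]
    rw [h1, ← mul_pow]
    refine pow_le_pow_left₀ (norm_nonneg _) ((norm_proj_le hL N _).trans ?_) 2
    exact norm_mulL2_le (hsl hχ.cont 0) (fun x hx => (hM 0 ⟨le_rfl, hT⟩ x hx).1) _
  have hsrc : ∫ t in (0:ℝ)..T, (1 / ε * ‖g₁ t‖ ^ 2 + ‖g₀ t‖ ^ 2) ≤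
      5 * M ^ 2 * K₀ * (‖y₀‖ ^ 2 + ‖h‖ ^ 2) := by
    have h1 : ∫ t in (0:ℝ)..T, (1 / ε * ‖g₁ t‖ ^ 2 + ‖g₀ t‖ ^ 2) ≤
        ∫ t in (0:ℝ)..T, 5 * M ^ 2 * ε * ‖y t‖ ^ 2 := by
      refine intervalIntegral.integral_mono_on hT (Continuous.intervalIntegrable (by fun_prop) _ _)
        (Continuous.intervalIntegrable (by fun_prop) _ _) fun t ht => ?_
      have e1 := norm_mulL2_le (hsl hχ.cont_x t) (fun x hx => (hM t ht x hx).2.1) (y t)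
      have e2 := norm_mulL2_le (hsl hχ.cont_xx t) (fun x hx => (hM t ht x hx).2.2) (y t)
      have e3 := pow_le_pow_left₀ (norm_nonneg _) e1 2
      have e4 := pow_le_pow_left₀ (norm_nonneg _) e2 2
      -- The commutator sources carry a factor ε, so even after the loss of 1/ε their square is of
      -- order ε‖y‖², which is what the global bound controls. The constant 5 is 4 from `g₁` plus 1
      -- from `g₀`.
      have e5 : 1 / ε * ‖g₁ t‖ ^ 2 = 4 * ε * ‖mulL2 (χx t) (y t)‖ ^ 2 := by
        simp only [hg₁, norm_smul, Real.norm_eq_abs, mul_pow, sq_abs]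
        field_simp; ring
      have e6 : ‖g₀ t‖ ^ 2 = ε * (ε * ‖mulL2 (χxx t) (y t)‖ ^ 2) := by
        simp only [hg₀, norm_smul, Real.norm_eq_abs, mul_pow, sq_abs]
        ring
      have e7 : ε * ‖mulL2 (χxx t) (y t)‖ ^ 2 ≤ (M * ‖y t‖) ^ 2 :=
        (mul_le_of_le_one_left (by positivity) hε1).trans e4
      have e8 := mul_le_mul_of_nonneg_left e7 hε.le
      have e9 := mul_le_mul_of_nonneg_left e3 (by positivity : 0 ≤ 4 * ε)
      rw [e5, e6]
      refine (add_le_add e9 e8).trans (le_of_eq (by ring))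
    rw [intervalIntegral.integral_const_mul] at h1
    have h2 := mul_le_mul_of_nonneg_left (hglob ε hε hε1 y₀ h y hy hsol)
      (by positivity : 0 ≤ 5 * M ^ 2)
    linarith
  set R : ℕ → ℝ := fun N => ∫ t in (0:ℝ)..T, ‖v t - proj L N (v t)‖ ^ 2 with hR
  have hRt : Tendsto R atTop (𝓝 0) := tendsto_integral_sub_proj hL T hvc
  have hpc := fun N => continuous_proj (L := L) N
  have hfin : ∀ N, ‖proj L N (v τ)‖ ^ 2 ≤ G * (M ^ 2 * ‖y₀‖ ^ 2 +
      (12 * C ^ 2 / ε * R N + 5 * M ^ 2 * K₀ * (‖y₀‖ ^ 2 + ‖h‖ ^ 2))) := by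
    intro N
    have := galerkin_energy (N := N) (by positivity) hε hε1 (orthonormal_mode hL)
      (norm_sq_dtrigSum hL N) (inner_transportSum_le hC hL ha hb N)
      (norm_transportSum_le hC hL ha hb N) hvc hg₀c hg₁c
      (Z := fun k t => inner ℝ (v t) (toL2 L (mode L k))) (fun k => by fun_prop)
      (fun k _ => hZeq k) τ hτ
    refine this.trans (mul_le_mul_of_nonneg_left (add_le_add (hpv0 N) ?_) hG0.le)
    simp only [add_assoc]
    change ∫ t in (0:ℝ)..T, (3 * (2 * C) ^ 2 / ε * ‖v t - proj L N (v t)‖ ^ 2 +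
      (1 / ε * ‖g₁ t‖ ^ 2 + ‖g₀ t‖ ^ 2)) ≤ _
    rw [intervalIntegral.integral_add (Continuous.intervalIntegrable (by fun_prop) _ _)
      (Continuous.intervalIntegrable (by fun_prop) _ _), intervalIntegral.integral_const_mul]
    refine add_le_add (le_of_eq ?_) hsrc
    simp only [hR]; ring
  have hlim : Tendsto (fun N => G * (M ^ 2 * ‖y₀‖ ^ 2 +
      (12 * C ^ 2 / ε * R N + 5 * M ^ 2 * K₀ * (‖y₀‖ ^ 2 + ‖h‖ ^ 2)))) atTop
      (𝓝 (G * (M ^ 2 * ‖y₀‖ ^ 2 +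
      (12 * C ^ 2 / ε * 0 + 5 * M ^ 2 * K₀ * (‖y₀‖ ^ 2 + ‖h‖ ^ 2))))) :=
    (((hRt.const_mul _).add_const _).const_add _).const_mul _
  have h1 := le_of_tendsto_of_tendsto' ((tendsto_proj hL (v τ)).norm.pow 2) hlim hfin
  refine h1.trans ?_
  rw [mul_zero, zero_add, mul_assoc G]
  refine mul_le_mul_of_nonneg_left ?_ hG0.le
  have h2 : 0 ≤ M ^ 2 * ‖h‖ ^ 2 := by positivity
  linarith

end Estimates

/-! ### Travel times and the zeros of the velocity -/

section TransportTime

/-- Near a simple zero on the left, the travel time is arbitrarily long. -/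
lemma exists_long_travel_right {f : ℝ → ℝ} {z u K : ℝ} (hzu : z < u) (hK : 0 < K)
    (hf : ContinuousOn f (Ioc z u)) (hne : ∀ x ∈ Ioc z u, f x ≠ 0)
    (hlip : ∀ x ∈ Ioc z u, |f x| ≤ K * (x - z)) (T : ℝ) :
    ∃ p ∈ Ioo z u, T < ∫ x in p..u, |f x|⁻¹ := by
  -- With p - z = r (u - z), the integral of 1/(K(x - z)) over [p, u] is -log r / K, here equal to
  -- |T| + 1.
  set r : ℝ := Real.exp (-(K * (|T| + 1))) with hr
  have hr0 : 0 < r := Real.exp_pos _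
  have hr1 : r < 1 := Real.exp_lt_one_iff.2 (by have := abs_nonneg T; nlinarith)
  set p : ℝ := z + (u - z) * r with hp
  have hzp : z < p := by have := mul_pos (sub_pos.2 hzu) hr0; linarith
  have hpu : p < u := by nlinarith [sub_pos.2 hzu]
  refine ⟨p, ⟨hzp, hpu⟩, ?_⟩
  have hd : ∀ x ∈ Icc p u, HasDerivAt (fun x => K⁻¹ * Real.log (x - z)) (K * (x - z))⁻¹ x := by
    intro x hx
    have h0 : x - z ≠ 0 := by linarith [hx.1]
    refine ((((hasDerivAt_id x).sub_const z).log h0).const_mul K⁻¹).congr_deriv ?_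
    rw [mul_inv]; simp
  have hc : ContinuousOn (fun x => (K * (x - z))⁻¹) (Icc p u) := by
    refine ContinuousOn.inv₀ (by fun_prop) fun x hx => ?_
    have : 0 < x - z := by linarith [hx.1]
    positivity
  have hint : ∫ x in p..u, (K * (x - z))⁻¹ = |T| + 1 := by
    rw [intervalIntegral.integral_eq_sub_of_hasDerivAt
      (fun x hx => hd x (by rwa [uIcc_of_le hpu.le] at hx)) (hc.intervalIntegrable_of_Icc hpu.le)]
    have h1 : p - z = (u - z) * r := by rw [hp]; ring
    rw [h1, Real.log_mul (sub_pos.2 hzu).ne' hr0.ne', hr, Real.log_exp]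
    field_simp; ring
  have hsub : Icc p u ⊆ Ioc z u := fun x hx => ⟨hzp.trans_le hx.1, hx.2⟩
  have hc2 : ContinuousOn (fun x => |f x|⁻¹) (Icc p u) :=
    ((hf.mono hsub).abs).inv₀ fun x hx => (abs_pos.2 (hne x (hsub hx))).ne'
  have hle : ∫ x in p..u, (K * (x - z))⁻¹ ≤ ∫ x in p..u, |f x|⁻¹ := by
    refine intervalIntegral.integral_mono_on hpu.le (hc.intervalIntegrable_of_Icc hpu.le)
      (hc2.intervalIntegrable_of_Icc hpu.le) fun x hx => ?_
    exact inv_anti₀ (abs_pos.2 (hne x (hsub hx))) (hlip x (hsub hx))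
  linarith [le_abs_self T]

variable {a : ℝ → ℝ} {L T : ℝ}

/-- This makes `a` vanish at least linearly at its zeros, so that 1/|a| is not integrable beside
them. -/
lemma exists_lipschitz_coeff (hL : 0 < L) (ha : ContDiffOn ℝ 1 a (Icc 0 L)) :
    ∃ K > 0, ∀ x ∈ Icc 0 L, ∀ z ∈ Icc 0 L, |a x - a z| ≤ K * |x - z| := by
  obtain ⟨K, hK⟩ := isCompact_Icc.exists_bound_of_continuousOn
    (continuousOn_derivWithin_coeff hL ha)
  refine ⟨|K| + 1, by positivity, fun x hx z hz => ?_⟩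
  exact (convex_Icc 0 L).norm_image_sub_le_of_norm_derivWithin_le
    (ha.differentiableOn one_ne_zero)
    (fun w hw => (hK w hw).trans (by linarith [le_abs_self K])) hz hx

/-- Either `a` vanishes identically, or it has an interval without zeros, compactly contained in
`(0,L)`, whose travel time exceeds `T`. -/
lemma eq_zero_or_exists_long_interval (hL : 0 < L) (ha : ContDiffOn ℝ 1 a (Icc 0 L)) (hT : 0 ≤ T)
    (hTa : ENNReal.ofReal T < transportTime a L) :
    (∀ x ∈ Icc 0 L, a x = 0) ∨ ∃ p q, 0 < p ∧ p < q ∧ q < L ∧ (∀ x ∈ Icc p q, a x ≠ 0) ∧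
      T < ∫ x in p..q, |a x|⁻¹ := by
  by_cases hz : ∃ z ∈ Ioo 0 L, a z = 0
  · obtain ⟨z, hz, haz⟩ := hz
    obtain ⟨K, hK, hlip⟩ := exists_lipschitz_coeff hL ha
    by_cases hu : ∃ u ∈ Ioo 0 L, a u ≠ 0
    · right
      obtain ⟨u, hu, hau⟩ := hu
      rcases lt_or_gt_of_ne (show z ≠ u by rintro rfl; exact hau haz) with hzu | huz
      · have hsub : Icc z u ⊆ Icc 0 L := Icc_subset_Icc hz.1.le hu.2.le
        have hcl : IsClosed (Icc z u ∩ a ⁻¹' {0}) :=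
          (ha.continuousOn.mono hsub).preimage_isClosed_of_isClosed isClosed_Icc isClosed_singleton
        -- The last zero before u, so that none remains in (w, u].
        obtain ⟨w, ⟨hw, haw⟩, hmax⟩ := (isCompact_Icc.of_isClosed_subset hcl
          inter_subset_left).exists_isGreatest ⟨z, ⟨le_rfl, hzu.le⟩, haz⟩
        have hwu : w < u := lt_of_le_of_ne hw.2 (by rintro rfl; exact hau haw)
        have hwsub : Ioc w u ⊆ Icc 0 L := fun x hx =>
          ⟨hz.1.le.trans (hw.1.trans hx.1.le), hx.2.trans hu.2.le⟩
        have hne : ∀ x ∈ Ioc w u, a x ≠ 0 := fun x hx h0 =>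
          absurd (hmax ⟨⟨hw.1.trans hx.1.le, hx.2⟩, h0⟩) (not_le.2 hx.1)
        obtain ⟨p, hp, hpT⟩ := exists_long_travel_right hwu hK (ha.continuousOn.mono hwsub) hne
          (fun x hx => by
            have := hlip x (hwsub hx) w (hsub hw)
            rw [show a w = 0 from haw, sub_zero, abs_of_pos (sub_pos.2 hx.1)] at this
            exact this) T
        exact ⟨p, u, hz.1.trans_le (hw.1.trans hp.1.le), hp.2, hu.2,
          fun x hx => hne x ⟨hp.1.trans_le hx.1, hx.2⟩, hpT⟩
      · have hsub : Icc u z ⊆ Icc 0 L := Icc_subset_Icc hu.1.le hz.2.le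
        have hcl : IsClosed (Icc u z ∩ a ⁻¹' {0}) :=
          (ha.continuousOn.mono hsub).preimage_isClosed_of_isClosed isClosed_Icc isClosed_singleton
        obtain ⟨w, ⟨hw, haw⟩, hmin⟩ := (isCompact_Icc.of_isClosed_subset hcl
          inter_subset_left).exists_isLeast ⟨z, ⟨huz.le, le_rfl⟩, haz⟩
        have hwu : u < w := lt_of_le_of_ne hw.1 (by rintro rfl; exact hau haw)
        have hwsub : Ico u w ⊆ Icc 0 L := fun x hx =>
          ⟨hu.1.le.trans hx.1, hx.2.le.trans (hw.2.trans hz.2.le)⟩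
        have hne : ∀ x ∈ Ico u w, a x ≠ 0 := fun x hx h0 =>
          absurd (hmin ⟨⟨hx.1, hx.2.le.trans hw.2⟩, h0⟩) (not_le.2 hx.2)
        have hneg : ∀ x ∈ Ioc (-w) (-u), -x ∈ Ico u w := fun x hx =>
          ⟨by linarith [hx.2], by linarith [hx.1]⟩
        -- Here w is the first zero after u; the reflection x ↦ -x reduces to the previous
        -- configuration.
        obtain ⟨p, hp, hpT⟩ := exists_long_travel_right (f := fun x => a (-x)) (neg_lt_neg hwu) hK
          ((ha.continuousOn.mono hwsub).comp continuous_neg.continuousOn hneg)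
          (fun x hx => hne (-x) (hneg x hx))
          (fun x hx => by
            have := hlip (-x) (hwsub (hneg x hx)) w (hsub hw)
            rw [show a w = 0 from haw, sub_zero, abs_sub_comm,
              abs_of_pos (sub_pos.2 (hneg x hx).2)] at this
            linarith) T
        rw [intervalIntegral.integral_comp_neg (fun x => |a x|⁻¹), neg_neg] at hpT
        exact ⟨u, -p, hu.1, by linarith [hp.2], by linarith [hp.1, hw.2, hz.2],
          fun x hx => hne x ⟨hx.1, by linarith [hx.2, hp.1]⟩, hpT⟩
    · left
      push Not at hu
      intro x hx
      rw [← closure_Ioo hL.ne] at hx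
      have hc := ha.continuousOn
      rw [← closure_Ioo hL.ne] at hc
      exact (isClosed_singleton (x := (0:ℝ))).closure_subset_iff.2
        (by rintro _ ⟨y, hy, rfl⟩; exact hu y hy) (hc.image_closure ⟨x, hx, rfl⟩)
  · right
    push Not at hz
    have hA : Tendsto (fun n : ℕ => L / 2 / ((n : ℝ) + 1)) atTop (𝓝 0) := by
      have := (tendsto_one_div_add_atTop_nhds_zero_nat (𝕜 := ℝ)).const_mul (L / 2)
      simpa [div_eq_mul_inv] using this
    have hB : Tendsto (fun n : ℕ => L - L / 2 / ((n : ℝ) + 1)) atTop (𝓝 L) := by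
      simpa using hA.const_sub L
    have hm : AEMeasurable (fun s => (ENNReal.ofReal |a s|)⁻¹) (volume.restrict (Ioo 0 L)) := by
      have : AEMeasurable a (volume.restrict (Ioo 0 L)) :=
        (ha.continuousOn.mono Ioo_subset_Icc_self).aemeasurable measurableSet_Ioo
      fun_prop
    have ht := (aecover_Ioo_of_Icc (μ := volume) hA hB).lintegral_tendsto_of_countably_generated hm
    -- For n = 0 the segment [L/(2(n+1)), L - L/(2(n+1))] is a single point; n ≥ 1 makes it
    -- nondegenerate.
    obtain ⟨n, hn⟩ := ((tendsto_order.1 ht).1 _ hTa).and (eventually_ge_atTop 1) |>.exists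
    obtain ⟨hn, hn1⟩ := hn
    have hn1' : (1:ℝ) ≤ n := by exact_mod_cast hn1
    set p := L / 2 / ((n : ℝ) + 1) with hp
    have hp0 : 0 < p := by positivity
    have hpL : p < L / 2 := div_lt_self (by positivity) (by linarith)
    have hsub : Icc p (L - p) ⊆ Ioo 0 L := fun x hx => ⟨by linarith [hx.1], by linarith [hx.2]⟩
    refine ⟨p, L - p, hp0, by linarith, by linarith, fun x hx => hz x (hsub hx), ?_⟩
    rw [Measure.restrict_restrict measurableSet_Icc, inter_eq_left.2 hsub] at hn
    have hc : ContinuousOn (fun x => |a x|⁻¹) (Icc p (L - p)) :=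
      ((ha.continuousOn.mono (hsub.trans Ioo_subset_Icc_self)).abs).inv₀
        fun x hx => (abs_pos.2 (hz x (hsub hx))).ne'
    have he : ∫⁻ s in Icc p (L - p), (ENNReal.ofReal |a s|)⁻¹ =
        ENNReal.ofReal (∫ s in Icc p (L - p), |a s|⁻¹) := by
      rw [ofReal_integral_eq_lintegral_ofReal hc.integrableOn_Icc
        (Eventually.of_forall fun s => by positivity)]
      refine setLIntegral_congr_fun measurableSet_Icc fun s hs => ?_
      exact (ENNReal.ofReal_inv_of_pos (abs_pos.2 (hz s (hsub hs)))).symm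
    rw [he, integral_Icc_eq_integral_Ioc,
      ← intervalIntegral.integral_of_le (by linarith)] at hn
    exact (ENNReal.ofReal_lt_ofReal_iff_of_nonneg hT).1 hn

end TransportTime

/-! ### Mollification of bounded coefficients -/

section Mollification

open scoped ContDiff Convolution

lemma norm_sq_toL2 {ℓ : ℝ} {f : ℝ → ℝ} (hf : MemLp f 2 (volume.restrict (Ioo (0 : ℝ) ℓ))) :
    ‖toL2 ℓ f‖ ^ 2 = ∫ x in Ioo 0 ℓ, f x ^ 2 := by
  rw [← real_inner_self_eq_norm_sq, inner_toL2_toL2 hf hf]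
  simp only [sq]

/-- Bounded functions are approximated in `L²(0,L)` by smooth functions with the same bound. -/
lemma exists_smooth_approx {L B : ℝ} {k : ℝ → ℝ} (hB : 0 ≤ B)
    (hk : MemLp k ⊤ (volume.restrict (Ioo 0 L)))
    (hkB : ∀ᵐ x ∂volume.restrict (Ioo 0 L), |k x| ≤ B) {δ : ℝ} (hδ : 0 < δ) :
    ∃ g : ℝ → ℝ, ContDiff ℝ ∞ g ∧ (∀ x, |g x| ≤ B) ∧ ‖toL2 L (fun x => g x - k x)‖ ≤ δ := by
  -- A measurable representative, truncated so that the bound B holds everywhere and not just almost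
  -- everywhere; averaging then preserves it.
  set k₁ : ℝ → ℝ := (Ioo 0 L).indicator fun x => max (-B) (min B (hk.1.mk k x)) with hk₁
  have hm : Measurable k₁ := by
    have := hk.1.stronglyMeasurable_mk.measurable
    exact (measurable_const.max (measurable_const.min this)).indicator measurableSet_Ioo
  have hk₁B : ∀ x, |k₁ x| ≤ B := by
    intro x
    by_cases hx : x ∈ Ioo 0 L
    · rw [hk₁, indicator_of_mem hx, abs_le]
      exact ⟨le_max_left _ _, max_le (by linarith) (min_le_left _ _)⟩
    · rw [hk₁, indicator_of_notMem hx]; simpa using hB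
  have hae : ∀ᵐ x ∂volume.restrict (Ioo 0 L), k₁ x = k x := by
    filter_upwards [ae_restrict_mem measurableSet_Ioo, hkB, hk.1.ae_eq_mk] with x hx h1 h2
    have h3 := abs_le.1 h1
    rw [hk₁, indicator_of_mem hx, ← h2, min_eq_right h3.2, max_eq_right h3.1]
  have hloc : LocallyIntegrable k₁ := by
    refine Integrable.locallyIntegrable ?_
    rw [hk₁, integrable_indicator_iff measurableSet_Ioo]
    refine Integrable.of_bound (C := B) ?_ (ae_of_all _ fun x => ?_)
    · have := hk.1.stronglyMeasurable_mk.measurable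
      exact (measurable_const.max (measurable_const.min this)).aestronglyMeasurable
    · rw [Real.norm_eq_abs, abs_le]
      exact ⟨le_max_left _ _, max_le (by linarith) (min_le_left _ _)⟩
  -- The inner radius is half the outer one: a fixed ratio of radii is what the almost everywhere
  -- convergence of the convolutions requires.
  set φ : ℕ → ContDiffBump (0 : ℝ) := fun n =>
    ⟨1 / ((n : ℝ) + 1) / 2, 1 / ((n : ℝ) + 1), by positivity, half_lt_self (by positivity)⟩ with hφ
  set g : ℕ → ℝ → ℝ := fun n => ((φ n).normed volume ⋆[ContinuousLinearMap.lsmul ℝ ℝ, volume] k₁)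
    with hg
  have hgs : ∀ n, ContDiff ℝ ∞ (g n) := fun n =>
    (φ n).hasCompactSupport_normed.contDiff_convolution_left _ (φ n).contDiff_normed hloc
  have hgB : ∀ n x, |g n x| ≤ B := by
    intro n x
    have := dist_convolution_le (μ := volume) (x₀ := x) (z₀ := (0:ℝ)) (g := k₁) hB
      (φ n).support_normed_eq.subset (φ n).nonneg_normed (φ n).integral_normed
      hm.aestronglyMeasurable (fun w _ => by simpa using hk₁B w)
    simpa using this
  have hlim : ∀ᵐ x, Tendsto (fun n => g n x) atTop (𝓝 (k₁ x)) :=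
    ContDiffBump.ae_convolution_tendsto_right_of_locallyIntegrable (K := 2)
      tendsto_one_div_add_atTop_nhds_zero_nat
      (Eventually.of_forall fun n => by
        change 1 / ((n : ℝ) + 1) ≤ 2 * (1 / ((n : ℝ) + 1) / 2)
        linarith) hloc
  have hmem : ∀ n, MemLp (fun x => g n x - k x) 2 (volume.restrict (Ioo 0 L)) := fun n =>
    (memLp_of_continuousOn (hgs n).continuous.continuousOn).sub (hk.mono_exponent le_top)
  have hint : Tendsto (fun n => ‖toL2 L (fun x => g n x - k x)‖ ^ 2) atTop (𝓝 0) := by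
    simp only [fun n => norm_sq_toL2 (hmem n)]
    suffices H : Tendsto (fun n => ∫ x in Ioo 0 L, (g n x - k x) ^ 2) atTop
        (𝓝 (∫ _ in Ioo 0 L, (0:ℝ))) by rwa [integral_zero] at H
    refine tendsto_integral_of_dominated_convergence (fun _ => (2 * B) ^ 2)
      (fun n => ((hmem n).1.pow 2)) (integrable_const _) (fun n => ?_) ?_
    · filter_upwards [hkB] with x hx
      rw [Real.norm_of_nonneg (sq_nonneg _), ← sq_abs]
      exact pow_le_pow_left₀ (abs_nonneg _)
        ((abs_sub _ _).trans (by linarith [hgB n x])) 2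
    · filter_upwards [ae_restrict_of_ae hlim, hae] with x h1 h2
      rw [h2] at h1
      simpa using (h1.sub_const (k x)).pow 2
  obtain ⟨n, hn⟩ := ((tendsto_order.1 hint).2 (δ ^ 2) (by positivity)).exists
  exact ⟨g n, hgs n, hgB n, (pow_lt_pow_iff_left₀ (norm_nonneg _) hδ.le two_ne_zero).1 hn |>.le⟩

end Mollification

/-! ### Extension of the velocity and travel coordinate -/

section Extension

variable {a b : ℝ → ℝ} {L T p q : ℝ}

lemma hasDerivAt_coeff (hp : 0 < p) (hq : q < L) (ha : ContDiffOn ℝ 1 a (Icc 0 L)) {x : ℝ}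
    (hx : x ∈ Icc p q) : HasDerivAt a (derivWithin a (Icc 0 L) x) x :=
  ((ha.differentiableOn one_ne_zero) x
    ⟨hp.le.trans hx.1, hx.2.trans hq.le⟩).hasDerivWithinAt.hasDerivAt
    (Icc_mem_nhds (hp.trans_le hx.1) (hx.2.trans_lt hq))

lemma hasDerivAt_integral_of_continuous {f : ℝ → ℝ} (hf : Continuous f) (c x : ℝ) :
    HasDerivAt (fun x => ∫ s in c..x, f s) (f x) x :=
  intervalIntegral.integral_hasDerivAt_right (hf.intervalIntegrable _ _)
    (hf.stronglyMeasurableAtFilter _ _) hf.continuousAt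

/-- A nonvanishing `C¹` function on a segment extends to a nonvanishing `C¹` function on `ℝ`. -/
lemma exists_nonvanishing_extension (hp : 0 < p) (hpq : p < q) (hq : q < L)
    (ha : ContDiffOn ℝ 1 a (Icc 0 L)) (hne : ∀ x ∈ Icc p q, a x ≠ 0) :
    ∃ A A' : ℝ → ℝ, Continuous A' ∧ (∀ x, HasDerivAt A (A' x) x) ∧
      ((∀ x, 0 < A x) ∨ ∀ x, A x < 0) ∧
      ∀ x ∈ Icc p q, A x = a x ∧ A' x = derivWithin a (Icc 0 L) x := by
  have hL : 0 < L := hp.trans (hpq.trans hq)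
  have hsub : Icc p q ⊆ Icc 0 L := Icc_subset_Icc hp.le hq.le
  -- The logarithmic derivative a'/a is extended by its end values and integrated. The extension
  -- a(p) exp(∫κ) then keeps a constant sign automatically.
  have hκc : ContinuousOn (fun x => derivWithin a (Icc 0 L) x / a x) (Icc p q) :=
    ((continuousOn_derivWithin_coeff hL ha).mono hsub).div (ha.continuousOn.mono hsub) hne
  obtain ⟨κ, hκ, hκeq⟩ : ∃ κ : ℝ → ℝ, Continuous κ ∧
      ∀ x ∈ Icc p q, κ x = derivWithin a (Icc 0 L) x / a x :=
    ⟨_, (continuousOn_iff_continuous_domRestrict.1 hκc).Icc_extend' (h := hpq.le),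
      fun t ht => IccExtend_of_mem hpq.le _ ht⟩
  set S : ℝ → ℝ := fun x => ∫ s in p..x, κ s with hS
  have hSd : ∀ x, HasDerivAt S (κ x) x := fun x => hasDerivAt_integral_of_continuous hκ p x
  have hSc : Continuous S := continuous_iff_continuousAt.2 fun x => (hSd x).continuousAt
  have hAeq : ∀ x ∈ Icc p q, a p * Real.exp (S x) = a x := by
    have hd : ∀ x ∈ Icc p q, HasDerivAt (fun x => a x * Real.exp (-S x)) 0 x := by
      intro x hx
      refine ((hasDerivAt_coeff hp hq ha hx).mul (hSd x).neg.exp).congr_deriv ?_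
      rw [hκeq x hx]
      have := hne x hx
      field_simp; ring
    intro x hx
    have h1 := (convex_Icc p q).is_const_of_fderivWithin_eq_zero (𝕜 := ℝ)
      (f := fun x => a x * Real.exp (-S x))
      (fun x hx => (hd x hx).differentiableAt.differentiableWithinAt) (fun x hx => by
        have hu : UniqueDiffWithinAt ℝ (Icc p q) x := uniqueDiffOn_Icc hpq x hx
        have := ((hd x hx).hasDerivWithinAt (s := Icc p q)).hasFDerivWithinAt.fderivWithin hu
        rw [this]; ext; simp) hx (left_mem_Icc.2 hpq.le)
    have h2 : S p = 0 := by simp [hS]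
    simp only [h2, neg_zero, Real.exp_zero, mul_one] at h1
    rw [← h1, mul_assoc, ← Real.exp_add]; simp
  refine ⟨fun x => a p * Real.exp (S x), fun x => a p * (Real.exp (S x) * κ x), by fun_prop,
    fun x => (hSd x).exp.const_mul _, ?_, fun x hx => ⟨hAeq x hx, ?_⟩⟩
  · rcases lt_or_gt_of_ne (hne p (left_mem_Icc.2 hpq.le)) with h | h
    · exact Or.inr fun x => mul_neg_of_neg_of_pos h (Real.exp_pos _)
    · exact Or.inl fun x => mul_pos h (Real.exp_pos _)
  · change a p * (Real.exp (S x) * κ x) = _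
    rw [← mul_assoc, hAeq x hx, hκeq x hx]
    have := hne x hx
    field_simp

/-- Travel coordinate: a window of transported initial positions staying in `(p,q)` up to
time `T`. -/
lemma exists_window {A s : ℝ → ℝ} (hT : 0 ≤ T) (hpq : p < q) (hA : Continuous A)
    (hsign : (∀ x, 0 < A x) ∨ ∀ x, A x < 0) (hs : ∀ x, HasDerivAt s (A x)⁻¹ x) (hsp : s p = 0)
    (hlong : T < ∫ x in p..q, |A x|⁻¹) :
    ∃ c r, 0 < r ∧ (∃ x ∈ Ioo p q, s x = c) ∧
      ∀ t ∈ Icc 0 T, ∀ x, |s x - t - c| < r → x ∈ Ioo p q := by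
  have hsc : Continuous s := continuous_iff_continuousAt.2 fun x => (hs x).continuousAt
  have hA0 : ∀ x, A x ≠ 0 := fun x => by
    rcases hsign with h | h
    · exact (h x).ne'
    · exact (h x).ne
  have hint : ∫ x in p..q, (A x)⁻¹ = s q := by
    rw [intervalIntegral.integral_eq_sub_of_hasDerivAt (fun x _ => hs x)
      ((hA.inv₀ hA0).intervalIntegrable _ _), hsp, sub_zero]
  rcases hsign with h | h
  · have hmono : StrictMono s := strictMono_of_hasDerivAt_pos hs fun x => inv_pos.2 (h x)
    simp only [fun x => abs_of_pos (h x), hint] at hlong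
    refine ⟨(s q - T) / 2, (s q - T) / 2, by linarith, ?_, fun t ht x hx => ?_⟩
    · exact intermediate_value_Ioo hpq.le hsc.continuousOn ⟨by rw [hsp]; linarith, by linarith⟩
    · rw [abs_lt] at hx
      exact ⟨hmono.lt_iff_lt.1 (by rw [hsp]; linarith [ht.1]),
        hmono.lt_iff_lt.1 (by linarith [ht.2])⟩
  · have hanti : StrictAnti s := strictAnti_of_hasDerivAt_neg hs fun x => inv_lt_zero.2 (h x)
    simp only [fun x => abs_of_neg (h x), inv_neg, intervalIntegral.integral_neg, hint] at hlong
    -- Now s maps (p, q) onto (s q, 0), and the choice is c - r = s q and c + r + T = 0.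
    refine ⟨-(-s q + T) / 2, (-s q - T) / 2, by linarith, ?_, fun t ht x hx => ?_⟩
    · exact intermediate_value_Ioo' hpq.le hsc.continuousOn ⟨by linarith, by rw [hsp]; linarith⟩
    · rw [abs_lt] at hx
      exact ⟨hanti.lt_iff_gt.1 (by rw [hsp]; linarith [ht.2]),
        hanti.lt_iff_gt.1 (by linarith [ht.1])⟩

end Extension

/-! ### Transported cutoffs and approximate adjoint solutions -/

section TestFunctions

open scoped ContDiff

variable {a b : ℝ → ℝ} {L T : ℝ}

/-- A cutoff `χ` transported by `a`, compactly supported in `(0,L)` on `[0,T]`, on whose support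
the adjoint transport equation has approximate `C^{1,2}` solutions that are bounded below. -/
structure IsTransportedCutoff (a b : ℝ → ℝ) (L T p q : ℝ) (χ χt χx χxx : ℝ → ℝ → ℝ) : Prop where
  isC12 : IsC12 χ χt χx χxx
  left_pos : 0 < p
  right_lt : q < L
  support : ∀ t ∈ Icc 0 T, ∀ x, χ t x ≠ 0 → x ∈ Icc p q
  transport : ∀ t ∈ Icc 0 T, ∀ x ∈ Icc 0 L, χt t x + a x * χx t x = 0
  ne_zero : ∃ x ∈ Icc p q, χ 0 x ≠ 0
  -- `c₀` is fixed before δ, so refining the approximation does not spoil the lower bound. The error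
  -- is required small only in L², all that mollification of a bounded function provides.
  approx : ∃ c₀ > 0, ∀ δ > 0, ∃ ψ ψt ψx ψxx : ℝ → ℝ → ℝ, ∃ e : ℝ → ℝ, IsC12 ψ ψt ψx ψxx ∧
    (∀ x ∈ Icc 0 L, c₀ ≤ ψ 0 x) ∧ MemLp e 2 (volume.restrict (Ioo 0 L)) ∧ ‖toL2 L e‖ ≤ δ ∧
    ∀ t ∈ Icc 0 T, ∀ x, χ t x ≠ 0 →
      |ψt t x + a x * ψx t x + (derivWithin a (Icc 0 L) x - b x) * ψ t x| ≤ |e x|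

lemma contDiff_hasDerivAt {f : ℝ → ℝ} (hf : ContDiff ℝ ∞ f) :
    (∀ x, HasDerivAt f (deriv f x) x) ∧ (∀ x, HasDerivAt (deriv f) (deriv (deriv f) x) x) ∧
      Continuous (deriv (deriv f)) := by
  have h1 : ContDiff ℝ ∞ (deriv f) := (contDiff_infty_iff_deriv.1 hf).2
  have h2 : ContDiff ℝ ∞ (deriv (deriv f)) := (contDiff_infty_iff_deriv.1 h1).2
  exact ⟨fun x => (hf.differentiable (by simp) x).hasDerivAt,
    fun x => (h1.differentiable (by simp) x).hasDerivAt, h2.continuous⟩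

lemma norm_toL2_const_mul (c : ℝ) {f : ℝ → ℝ} (hf : MemLp f 2 (volume.restrict (Ioo 0 L))) :
    ‖toL2 L (fun x => c * f x)‖ = |c| * ‖toL2 L f‖ := by
  rw [toL2_const_mul c hf, norm_smul, Real.norm_eq_abs]

lemma exists_bump (c : ℝ) {r : ℝ} (hr : 0 < r) :
    ∃ f : ℝ → ℝ, ContDiff ℝ ∞ f ∧ f c = 1 ∧ (∀ u, 0 ≤ f u) ∧ ∀ u, ¬ |u - c| < r → f u = 0 := by
  set f : ContDiffBump c := ⟨r / 2, r, by positivity, by linarith⟩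
  refine ⟨f, f.contDiff, f.one_of_mem_closedBall (Metric.mem_closedBall_self f.rIn_pos.le),
    fun u => f.nonneg, fun u hu => ?_⟩
  have : u ∉ Function.support f := by
    rw [f.support_eq, Metric.mem_ball, Real.dist_eq]; exact hu
  simpa using this

/-- The cutoff when `a` vanishes identically. -/
lemma exists_cutoff_of_eq_zero (hL : 0 < L)
    (hb : MemLp b ⊤ (volume.restrict (Ioo 0 L))) (ha0 : ∀ x ∈ Icc 0 L, a x = 0) :
    ∃ p q χ χt χx χxx, IsTransportedCutoff a b L T p q χ χt χx χxx := by
  have hda : ∀ x ∈ Icc 0 L, derivWithin a (Icc 0 L) x = 0 := fun x hx => by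
    rw [derivWithin_congr (f := fun _ => (0:ℝ)) (fun z hz => ha0 z hz) (ha0 x hx)]
    simp
  obtain ⟨f, hf, hfc, -, hf0⟩ := exists_bump (L / 2) (by positivity : 0 < L / 4)
  obtain ⟨f1, f2, f3⟩ := contDiff_hasDerivAt hf
  have hsub : Icc (L / 4) (3 * L / 4) ⊆ Icc 0 L := Icc_subset_Icc (by linarith) (by linarith)
  have hsupp : ∀ x, f x ≠ 0 → x ∈ Icc (L / 4) (3 * L / 4) := by
    intro x hx
    have h1 := not_imp_comm.1 (hf0 x) hx
    rw [abs_lt] at h1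
    exact ⟨by linarith [h1.1], by linarith [h1.2]⟩
  refine ⟨L / 4, 3 * L / 4, _, _, _, _, IsC12.of_space f1 f2 f3, by positivity, by linarith,
    fun t _ x hx => hsupp x hx, fun t _ x hx => by simp [ha0 x hx],
    ⟨L / 2, ⟨by linarith, by linarith⟩, ?_⟩, 1, one_pos, fun δ hδ => ?_⟩
  · rw [hfc]; exact one_ne_zero
  · obtain ⟨B, hB, hbB⟩ := exists_bound_ae_of_memLp_top hb
    set M : ℝ := Real.exp (T * B) with hM
    have hM0 : 0 < M := Real.exp_pos _
    obtain ⟨g, hg, hgB, hgδ⟩ := exists_smooth_approx hB hb hbB (div_pos hδ hM0)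
    obtain ⟨g1, g2, g3⟩ := contDiff_hasDerivAt hg
    have hgc := hg.continuous
    have hgc1 : Continuous (deriv g) := continuous_iff_continuousAt.2 fun x => (g2 x).continuousAt
    have hmem : MemLp (fun x => g x - b x) 2 (volume.restrict (Ioo 0 L)) :=
      (memLp_of_continuousOn hgc.continuousOn).sub (hb.mono_exponent le_top)
    -- Without transport the adjoint equation is ψ_t = b ψ. With g ≈ b, the function exp(t g) leaves
    -- the residual exp(t g)(g - b), and exp(t g) ≤ M on [0, T].
    refine ⟨fun t x => Real.exp (t * g x), fun t x => g x * Real.exp (t * g x),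
      fun t x => t * deriv g x * Real.exp (t * g x),
      fun t x => (t * deriv (deriv g) x + (t * deriv g x) ^ 2) * Real.exp (t * g x),
      fun x => M * (g x - b x), ⟨?_, ?_, ?_, ?_, fun t x => ?_, fun t x => ?_, fun t x => ?_⟩,
      fun x _ => by simp, hmem.const_mul M, ?_, fun t ht x hx => ?_⟩
    · simp only [Function.uncurry_def]; fun_prop
    · simp only [Function.uncurry_def]; fun_prop
    · simp only [Function.uncurry_def]; fun_prop
    · simp only [Function.uncurry_def]; fun_prop
    · refine ((hasDerivAt_mul_const (x := t) (g x)).exp).congr_deriv (mul_comm _ _)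
    · exact (((g1 x).const_mul t).exp).congr_deriv (mul_comm _ _)
    · refine (((g2 x).const_mul t).mul (((g1 x).const_mul t).exp)).congr_deriv ?_
      ring
    · rw [norm_toL2_const_mul M hmem, abs_of_pos hM0]
      rw [le_div_iff₀ hM0] at hgδ
      linarith
    · have hxL := hsub (hsupp x hx)
      rw [ha0 x hxL, hda x hxL]
      have h1 : g x * Real.exp (t * g x) + 0 * (t * deriv g x * Real.exp (t * g x)) +
          (0 - b x) * Real.exp (t * g x) = Real.exp (t * g x) * (g x - b x) := by ring
      rw [h1, abs_mul, abs_mul, abs_of_pos hM0, Real.abs_exp]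
      refine mul_le_mul_of_nonneg_right (Real.exp_le_exp.2 ?_) (abs_nonneg _)
      calc t * g x ≤ t * B := mul_le_mul_of_nonneg_left ((le_abs_self _).trans (hgB x)) ht.1
        _ ≤ T * B := mul_le_mul_of_nonneg_right ht.2 hB

/-- The cutoff near an interval without zeros of `a`. -/
lemma exists_cutoff_of_long_interval {p q : ℝ} (hT : 0 ≤ T) (ha : ContDiffOn ℝ 1 a (Icc 0 L))
    (hb : MemLp b ⊤ (volume.restrict (Ioo 0 L))) (hp : 0 < p) (hpq : p < q) (hq : q < L)
    (hne : ∀ x ∈ Icc p q, a x ≠ 0) (hlong : T < ∫ x in p..q, |a x|⁻¹) :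
    ∃ χ χt χx χxx, IsTransportedCutoff a b L T p q χ χt χx χxx := by
  have hL : 0 < L := hp.trans (hpq.trans hq)
  obtain ⟨A, A', hA'c, hAd, hsign, hAa⟩ := exists_nonvanishing_extension hp hpq hq ha hne
  have hAc : Continuous A := continuous_iff_continuousAt.2 fun x => (hAd x).continuousAt
  have hA0 : ∀ x, A x ≠ 0 := fun x => by
    rcases hsign with h | h
    · exact (h x).ne'
    · exact (h x).ne
  have hAic : Continuous fun x => (A x)⁻¹ := hAc.inv₀ hA0
  set s : ℝ → ℝ := fun x => ∫ z in p..x, (A z)⁻¹ with hs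
  have hsd : ∀ x, HasDerivAt s (A x)⁻¹ x := fun x => hasDerivAt_integral_of_continuous hAic p x
  have hsc : Continuous s := continuous_iff_continuousAt.2 fun x => (hsd x).continuousAt
  have hAid : ∀ x, HasDerivAt (fun x => (A x)⁻¹) (-(A' x) / A x ^ 2) x := fun x =>
    (hAd x).fun_inv (hA0 x)
  have hlong' : T < ∫ x in p..q, |A x|⁻¹ := by
    refine hlong.trans_eq (intervalIntegral.integral_congr fun x hx => ?_)
    rw [uIcc_of_le hpq.le] at hx
    simp only [(hAa x hx).1]
  obtain ⟨c, r, hr, ⟨x₀, hx₀, hsx₀⟩, hwin⟩ :=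
    exists_window hT hpq hAc hsign hsd (by simp [hs]) hlong'
  obtain ⟨f, hf, hfc0, hfnn, hf0⟩ := exists_bump c hr
  obtain ⟨f1, f2, f3⟩ := contDiff_hasDerivAt hf
  have hfc : Continuous f := hf.continuous
  have hfc1 : Continuous (deriv f) := continuous_iff_continuousAt.2 fun x => (f2 x).continuousAt
  have hsupp : ∀ t ∈ Icc 0 T, ∀ x, x ∉ Icc p q → ¬ |s x - t - c| < r := fun t ht x hx hmem =>
    hx (Ioo_subset_Icc_self (hwin t ht x hmem))
  -- A zero of a nonnegative function is a minimum; this covers the edge |u - c| = r as well.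
  have hdf0 : ∀ u, ¬ |u - c| < r → deriv f u = 0 := fun u hu => by
    have h1 : IsLocalMin f u := Eventually.of_forall fun v => by
      rw [hf0 u hu]; exact hfnn v
    exact h1.deriv_eq_zero
  -- In the coordinate s, with s' = 1/A, transport by A is translation at unit speed, so f(s(x) - t)
  -- is transported.
  have hchi : IsC12 (fun t x => f (s x - t)) (fun t x => -deriv f (s x - t))
      (fun t x => deriv f (s x - t) * (A x)⁻¹)
      (fun t x => deriv (deriv f) (s x - t) * (A x)⁻¹ * (A x)⁻¹ +
        deriv f (s x - t) * (-(A' x) / A x ^ 2)) := by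
    refine ⟨?_, ?_, ?_, ?_, fun t x => ?_, fun t x => ?_, fun t x => ?_⟩
    · simp only [Function.uncurry_def]; fun_prop
    · simp only [Function.uncurry_def]; fun_prop
    · have h1 : Continuous fun w : ℝ × ℝ => deriv f (s w.2 - w.1) := by fun_prop
      exact h1.mul (hAic.comp continuous_snd)
    · have h1 : Continuous fun w : ℝ × ℝ => deriv f (s w.2 - w.1) := by fun_prop
      have h2 : Continuous fun w : ℝ × ℝ => deriv (deriv f) (s w.2 - w.1) := by fun_prop
      have h3 : Continuous fun x => -(A' x) / A x ^ 2 :=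
        hA'c.neg.div (hAc.pow 2) fun x => pow_ne_zero 2 (hA0 x)
      have h4 : Continuous fun w : ℝ × ℝ => (A w.2)⁻¹ := hAic.comp continuous_snd
      exact ((h2.mul h4).mul h4).add (h1.mul (h3.comp continuous_snd))
    · refine (HasDerivAt.comp t (h₂ := f) (f1 (s x - t))
        ((hasDerivAt_id t).const_sub (s x))).congr_deriv ?_
      ring
    · exact HasDerivAt.comp x (h₂ := f) (f1 (s x - t)) ((hsd x).sub_const t)
    · exact (HasDerivAt.comp x (h₂ := deriv f) (f2 (s x - t)) ((hsd x).sub_const t)).mul (hAid x)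
  -- A time-independent solution of A ψ' + (A' - b) ψ = 0 is the exponential of a primitive of this
  -- function. Replacing it by a smooth g with the same bound B leaves the residual A exp(S)(g - k),
  -- where k denotes this function, and keeps ψ ≥ exp(-B L) whatever δ is.
  have hk : MemLp (fun x => (A x)⁻¹ * (b x - A' x)) ⊤ (volume.restrict (Ioo 0 L)) :=
    (hb.sub (memLp_of_continuousOn hA'c.continuousOn)).mul (p := ⊤) (q := ⊤) (r := ⊤)
      (memLp_of_continuousOn hAic.continuousOn)
  obtain ⟨B, hB, hkB⟩ := exists_bound_ae_of_memLp_top hk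
  obtain ⟨M₀, hM₀⟩ := isCompact_Icc.exists_bound_of_continuousOn
    (hAc.continuousOn (s := Icc 0 L))
  set M : ℝ := (|M₀| + 1) * Real.exp (B * L) with hM
  have hM0 : 0 < M := by positivity
  refine ⟨_, _, _, _, hchi, hp, hq, fun t ht x hx => ?_, fun t ht x hx => ?_,
    ⟨x₀, Ioo_subset_Icc_self hx₀, ?_⟩, Real.exp (-(B * L)), Real.exp_pos _, fun δ hδ => ?_⟩
  · by_contra h
    exact hx (hf0 _ (hsupp t ht x h))
  · by_cases h : x ∈ Icc p q
    · rw [← (hAa x h).1]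
      have := hA0 x
      field_simp; ring
    · simp [hdf0 _ (hsupp t ht x h)]
  · simp only [hsx₀, sub_zero]
    rw [hfc0]; exact one_ne_zero
  · obtain ⟨g, hg, hgB, hgδ⟩ := exists_smooth_approx hB hk hkB (div_pos hδ hM0)
    obtain ⟨g1, -, -⟩ := contDiff_hasDerivAt hg
    have hgc := hg.continuous
    have hgc1 : Continuous (deriv g) := hg.continuous_deriv (by simp)
    have hmem : MemLp (fun x => g x - (A x)⁻¹ * (b x - A' x)) 2 (volume.restrict (Ioo 0 L)) :=
      (memLp_of_continuousOn hgc.continuousOn).sub (hk.mono_exponent le_top)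
    set S : ℝ → ℝ := fun x => ∫ z in (0:ℝ)..x, g z with hS
    have hSd : ∀ x, HasDerivAt S (g x) x := fun x => hasDerivAt_integral_of_continuous hgc 0 x
    have hSB : ∀ x ∈ Icc 0 L, |S x| ≤ B * L := by
      intro x hx
      have := intervalIntegral.norm_integral_le_of_norm_le_const (a := 0) (b := x) (f := g) (C := B)
        fun z _ => hgB z
      rw [sub_zero, abs_of_nonneg hx.1] at this
      exact this.trans (mul_le_mul_of_nonneg_left hx.2 hB)
    have hE : ∀ x, HasDerivAt (fun x => Real.exp (S x)) (Real.exp (S x) * g x) x :=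
      fun x => (hSd x).exp
    have hSc : Continuous S := continuous_iff_continuousAt.2 fun x => (hSd x).continuousAt
    refine ⟨_, _, _, _, fun x => M * (g x - (A x)⁻¹ * (b x - A' x)),
      IsC12.of_space hE (fun x => (hE x).mul (g1 x)) (by fun_prop), fun x hx => ?_,
      hmem.const_mul M, ?_, fun t ht x hx => ?_⟩
    · exact Real.exp_le_exp.2 (by linarith [(abs_le.1 (hSB x hx)).1])
    · rw [norm_toL2_const_mul M hmem, abs_of_pos hM0]
      rw [le_div_iff₀ hM0] at hgδ
      linarith
    · have hxpq : x ∈ Icc p q := by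
        by_contra h
        exact hx (hf0 _ (hsupp t ht x h))
      have hxL : x ∈ Icc 0 L := Icc_subset_Icc hp.le hq.le hxpq
      rw [← (hAa x hxpq).1, ← (hAa x hxpq).2]
      have h1 : 0 + A x * (Real.exp (S x) * g x) + (A' x - b x) * Real.exp (S x) =
          (A x * Real.exp (S x)) * (g x - (A x)⁻¹ * (b x - A' x)) := by
        have := hA0 x
        field_simp; ring
      rw [h1, abs_mul, abs_mul M, abs_of_pos hM0]
      refine mul_le_mul_of_nonneg_right ?_ (abs_nonneg _)
      rw [abs_mul, Real.abs_exp]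
      refine mul_le_mul ((hM₀ x hxL).trans (by linarith [le_abs_self M₀]))
        (Real.exp_le_exp.2 ((le_abs_self _).trans (hSB x hxL))) (Real.exp_pos _).le (by positivity)

lemma exists_cutoff (hL : 0 < L) (hT : 0 ≤ T) (ha : ContDiffOn ℝ 1 a (Icc 0 L))
    (hb : MemLp b ⊤ (volume.restrict (Ioo 0 L)))
    (hTa : ENNReal.ofReal T < transportTime a L) :
    ∃ p q χ χt χx χxx, IsTransportedCutoff a b L T p q χ χt χx χxx := by
  rcases eq_zero_or_exists_long_interval hL ha hT hTa with h | ⟨p, q, hp, hpq, hq, hne, hlong⟩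
  · exact exists_cutoff_of_eq_zero hL hb h
  · exact ⟨p, q, exists_cutoff_of_long_interval hT ha hb hp hpq hq hne hlong⟩

end TestFunctions

/-! ### The duality argument and the blow-up of the cost -/

section Cost

variable {a b : ℝ → ℝ} {L T : ℝ}

lemma integral_abs_mul_abs_le {ℓ : ℝ} (u v : L2 ℓ) :
    Integrable (fun x => |u x| * |v x|) (volume.restrict (Ioo 0 ℓ)) ∧
      ∫ x in Ioo 0 ℓ, |u x| * |v x| ≤ ‖u‖ * ‖v‖ := by
  have hae : (fun x => |u| x * |v| x) =ᵐ[volume.restrict (Ioo 0 ℓ)]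
      fun x => |u x| * |v x| := by
    filter_upwards [Lp.coeFn_abs u, Lp.coeFn_abs v] with x h1 h2
    rw [h1, h2]
  refine ⟨(integrable_mul_L2 |u| |v|).congr hae, ?_⟩
  rw [← integral_congr_ae hae, ← inner_eq_integral]
  refine (real_inner_le_norm _ _).trans ?_
  rw [norm_abs_eq_norm, norm_abs_eq_norm]

variable {p q : ℝ} {χ χt χx χxx : ℝ → ℝ → ℝ}

lemma IsTransportedCutoff.eq_zero_of_notMem (h : IsTransportedCutoff a b L T p q χ χt χx χxx)
    {t : ℝ} (ht : t ∈ Icc 0 T) {x : ℝ} (hx : x ∉ Icc p q) : χ t x = 0 :=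
  not_not.1 fun h0 => hx (h.support t ht x h0)

lemma IsTransportedCutoff.left_eq_zero (h : IsTransportedCutoff a b L T p q χ χt χx χxx)
    {t : ℝ} (ht : t ∈ Icc 0 T) : χ t 0 = 0 :=
  h.eq_zero_of_notMem ht fun hx => absurd hx.1 (not_le.2 h.left_pos)

lemma IsTransportedCutoff.right_eq_zero (h : IsTransportedCutoff a b L T p q χ χt χx χxx)
    {t : ℝ} (ht : t ∈ Icc 0 T) : χ t L = 0 :=
  h.eq_zero_of_notMem ht fun hx => absurd hx.2 (not_le.2 h.right_lt)

/-- The cutoff vanishes on a whole neighbourhood of 0, negative x included. This removes the control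
from the duality identity. -/
lemma IsTransportedCutoff.deriv_left_eq_zero (h : IsTransportedCutoff a b L T p q χ χt χx χxx)
    {t : ℝ} (ht : t ∈ Icc 0 T) : χx t 0 = 0 := by
  have h1 : (fun x => χ t x) =ᶠ[𝓝 0] fun _ => 0 := by
    filter_upwards [Iio_mem_nhds h.left_pos] with x hx
    exact h.eq_zero_of_notMem ht fun hx' => absurd hx'.1 (not_le.2 hx)
  exact (h.isC12.deriv_x t 0).unique ((hasDerivAt_const (0:ℝ) (0:ℝ)).congr_of_eventuallyEq h1)

lemma IsTransportedCutoff.norm_pos (h : IsTransportedCutoff a b L T p q χ χt χx χxx) :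
    0 < ‖toL2 L (χ 0)‖ := by
  have hc : Continuous (χ 0) := by have := h.isC12.cont; fun_prop
  obtain ⟨x₀, hx₀, hne⟩ := h.ne_zero
  have hx₀L : x₀ ∈ Ioo 0 L := ⟨h.left_pos.trans_le hx₀.1, hx₀.2.trans_lt h.right_lt⟩
  have hmem := memLp_of_continuousOn (p := 2) (ℓ := L) hc.continuousOn
  refine norm_pos_iff.2 fun h0 => hne ?_
  have h1 : χ 0 =ᵐ[volume.restrict (Ioo 0 L)] fun _ => (0:ℝ) := by
    filter_upwards [coeFn_toL2 hmem, Lp.coeFn_zero ℝ 2 (volume.restrict (Ioo 0 L))] with x h1 h2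
    rw [← h1, h0, h2]; rfl
  exact Measure.eqOn_open_of_ae_eq h1 isOpen_Ioo hc.continuousOn continuousOn_const hx₀L

/-- Along a transported cutoff, a null control must be large when the viscosity is small. -/
lemma IsTransportedCutoff.eventually_le_norm (hL : 0 < L) (hT : 0 ≤ T)
    (ha : ContDiffOn ℝ 1 a (Icc 0 L)) (hb : MemLp b ⊤ (volume.restrict (Ioo 0 L)))
    (hχ : IsTransportedCutoff a b L T p q χ χt χx χxx) {R : ℝ} :
    ∀ᶠ ε in 𝓝[>] (0:ℝ), ∀ h ∈ nullControls a b L T ε (‖toL2 L (χ 0)‖⁻¹ • toL2 L (χ 0)),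
      R ≤ ‖h‖ := by
  obtain ⟨Kg, hKg, hglob⟩ := exists_global_bound hL hT ha hb
  obtain ⟨Kl, hKl, hloc⟩ := exists_local_bound hL hT ha hb hχ.isC12 hχ.transport
    fun t ht => hχ.left_eq_zero ht
  have hX := hχ.norm_pos
  have hcont0 : Continuous (χ 0) := by have := hχ.isC12.cont; fun_prop
  have hmem0 := memLp_of_continuousOn (p := 2) (ℓ := L) hcont0.continuousOn
  set X := toL2 L (χ 0) with hXdef
  obtain ⟨c₀, hc₀, happrox⟩ := hχ.approx
  set m : ℝ := c₀ * ‖X‖ with hm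
  have hm0 : 0 < m := mul_pos hc₀ hX
  set V : ℝ := √(Kl * (1 + R ^ 2)) with hV
  -- This δ makes the residual contribution T V δ at most m/4, where V bounds ‖χ y‖ if ‖h‖ ≤ R. It
  -- must precede the choice of ε: the bound M on (χψ)_xx depends on ψ, hence on δ, so only then can
  -- ε be taken small.
  obtain ⟨ψ, ψt, ψx, ψxx, e, hψ, hψ0, he, heδ, hres⟩ :=
    happrox (m / (4 * (T * V + 1))) (by positivity)
  have hφ := hχ.isC12.mul hψ
  obtain ⟨M, hM0, hM⟩ := hφ.exists_bound L T
  set Q : ℝ := ‖toL2 L (fun _ => M)‖ with hQ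
  have hmemM : MemLp (fun _ : ℝ => M) 2 (volume.restrict (Ioo 0 L)) := memLp_const M
  have hsmall : ∀ᶠ ε in 𝓝[>] (0:ℝ), Q * (√ε / 2 * (T + Kg * (1 + R ^ 2))) < m / 4 := by
    have h1 : Tendsto (fun ε => Q * (√ε / 2 * (T + Kg * (1 + R ^ 2)))) (𝓝[>] (0:ℝ))
        (𝓝 (Q * (√0 / 2 * (T + Kg * (1 + R ^ 2))))) := by
      refine (Continuous.tendsto ?_ 0).mono_left nhdsWithin_le_nhds
      fun_prop
    refine (tendsto_order.1 h1).2 _ ?_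
    simp only [Real.sqrt_zero, zero_div, zero_mul, mul_zero]
    positivity
  filter_upwards [hsmall, self_mem_nhdsWithin, mem_nhdsWithin_of_mem_nhds (Iio_mem_nhds one_pos)]
    with ε hεs hε hε1 h hh
  have hε : 0 < ε := hε
  have hε1 : ε ≤ 1 := le_of_lt hε1
  by_contra hlt
  push Not at hlt
  obtain ⟨y', hsol', hy'T⟩ := hh
  obtain ⟨y, hy, hsol, hyT⟩ := hsol'.exists_continuous hT
  rw [hy'T] at hyT
  have hy₀ : ‖‖X‖⁻¹ • X‖ = 1 := by
    rw [norm_smul, norm_inv, norm_norm, inv_mul_cancel₀ hX.ne']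
  have hdata : ‖‖X‖⁻¹ • X‖ ^ 2 + ‖h‖ ^ 2 ≤ 1 + R ^ 2 := by
    rw [hy₀]
    have := pow_le_pow_left₀ (norm_nonneg h) hlt.le 2
    linarith
  have hyb : ε * ∫ t in (0:ℝ)..T, ‖y t‖ ^ 2 ≤ Kg * (1 + R ^ 2) :=
    (hglob ε hε hε1 _ h y hy hsol).trans (mul_le_mul_of_nonneg_left hdata hKg)
  have hvb : ∀ t ∈ Icc 0 T, ‖mulL2 (χ t) (y t)‖ ≤ V := fun t ht =>
    Real.le_sqrt_of_sq_le
      ((hloc ε hε hε1 _ h y hy hsol t ht).trans (mul_le_mul_of_nonneg_left hdata hKl))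
  have key := hsol.transposition T ⟨hT, le_rfl⟩ _ _ _ _ (hφ.isTestFunction (L := L) (τ := T)
    (fun t ht => by simp [hχ.left_eq_zero ht]) (fun t ht => by simp [hχ.right_eq_zero ht]))
  have hbd : ∫ t in Ioo 0 T, h t * (χx t 0 * ψ t 0 + χ t 0 * ψx t 0) = 0 := by
    rw [setIntegral_congr_fun (g := fun _ => (0:ℝ)) measurableSet_Ioo, integral_zero]
    intro t ht
    have ht' := Ioo_subset_Icc_self ht
    simp [hχ.left_eq_zero ht', hχ.deriv_left_eq_zero ht']
  have hend : ∫ x in Ioo 0 L, y T x * (χ T x * ψ T x) = 0 := by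
    rw [hyT, integral_congr_ae (g := fun _ => (0:ℝ)), integral_zero]
    filter_upwards [Lp.coeFn_zero ℝ 2 (volume.restrict (Ioo 0 L))] with x hx
    change ((0 : L2 L) : ℝ → ℝ) x * _ = 0
    rw [hx, Pi.zero_apply, zero_mul]
  have hinit : m ≤ ∫ x in Ioo 0 L, (‖X‖⁻¹ • X : L2 L) x * (χ 0 x * ψ 0 x) := by
    have h1 : ∫ x in Ioo 0 L, (‖X‖⁻¹ • X : L2 L) x * (χ 0 x * ψ 0 x) =
        ∫ x in Ioo 0 L, ‖X‖⁻¹ * (χ 0 x ^ 2 * ψ 0 x) := by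
      refine integral_congr_ae ?_
      filter_upwards [Lp.coeFn_smul (‖X‖⁻¹) X, coeFn_toL2 hmem0] with x h1 h2
      rw [h1, Pi.smul_apply, hXdef, h2, smul_eq_mul]; ring
    have h2 : m = ∫ x in Ioo 0 L, ‖X‖⁻¹ * (χ 0 x ^ 2 * c₀) := by
      rw [integral_const_mul, integral_mul_const, ← norm_sq_toL2 hmem0, ← hXdef, hm]
      field_simp
    have hcψ : Continuous (ψ 0) := by have := hψ.cont; fun_prop
    rw [h1, h2]
    refine setIntegral_mono_on ?_ ?_ measurableSet_Ioo fun x hx => ?_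
    · exact ((by fun_prop : Continuous fun x => ‖X‖⁻¹ * (χ 0 x ^ 2 * c₀)).continuousOn
        (s := Icc 0 L)).integrableOn_Icc.mono_set Ioo_subset_Icc_self
    · exact ((by fun_prop : Continuous fun x => ‖X‖⁻¹ * (χ 0 x ^ 2 * ψ 0 x)).continuousOn
        (s := Icc 0 L)).integrableOn_Icc.mono_set Ioo_subset_Icc_self
    · have := hψ0 x (Ioo_subset_Icc_self hx)
      gcongr
  have hslice : ∀ t ∈ Icc 0 T, |∫ x in Ioo 0 L, y t x * adjointExpr a b L ε
      (fun t x => χ t x * ψ t x) (fun t x => χt t x * ψ t x + χ t x * ψt t x)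
      (fun t x => χx t x * ψ t x + χ t x * ψx t x)
      (fun t x => χxx t x * ψ t x + 2 * (χx t x * ψx t x) + χ t x * ψxx t x) t x| ≤
      V * (m / (4 * (T * V + 1))) + Q * (ε * ‖y t‖) := by
    intro t ht
    obtain ⟨i1, b1⟩ := integral_abs_mul_abs_le (mulL2 (χ t) (y t)) (toL2 L e)
    obtain ⟨i2, b2⟩ := integral_abs_mul_abs_le (y t) (toL2 L fun _ => M)
    have hle := norm_integral_le_of_norm_le (f := fun x => y t x * adjointExpr a b L ε
      (fun t x => χ t x * ψ t x) (fun t x => χt t x * ψ t x + χ t x * ψt t x)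
      (fun t x => χx t x * ψ t x + χ t x * ψx t x)
      (fun t x => χxx t x * ψ t x + 2 * (χx t x * ψx t x) + χ t x * ψxx t x) t x)
      (i1.add (i2.const_mul ε)) ?_
    · simp only [Pi.add_apply] at hle
      rw [integral_add i1 (i2.const_mul ε), integral_const_mul, Real.norm_eq_abs] at hle
      have e1 : ‖mulL2 (χ t) (y t)‖ * ‖toL2 L e‖ ≤ V * (m / (4 * (T * V + 1))) :=
        mul_le_mul (hvb t ht) heδ (norm_nonneg _) (Real.sqrt_nonneg _)
      have e2 := mul_le_mul_of_nonneg_left b2 hε.le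
      refine hle.trans ((add_le_add (b1.trans e1) e2).trans (le_of_eq ?_))
      rw [← hQ]; ring
    · filter_upwards [ae_restrict_mem measurableSet_Ioo, coeFn_toL2 he, coeFn_toL2 hmemM,
        coeFn_mulL2 (memLp_slice hχ.isC12.cont t ⊤) (y t)] with x hx h1 h2 h3
      have hxL := Ioo_subset_Icc_self hx
      have htr := hχ.transport t ht x hxL
      have hMx := (hM t ht x hxL).2.2
      simp only [Pi.add_apply]
      rw [h1, h2, h3, abs_of_nonneg hM0, abs_mul]
      -- The transport equation of χ removes every term in which the first order operator
      -- differentiates the cutoff; the residual of ψ appears multiplied by χ y, to which the local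
      -- bound applies.
      have hsplit : y t x * adjointExpr a b L ε
          (fun t x => χ t x * ψ t x) (fun t x => χt t x * ψ t x + χ t x * ψt t x)
          (fun t x => χx t x * ψ t x + χ t x * ψx t x)
          (fun t x => χxx t x * ψ t x + 2 * (χx t x * ψx t x) + χ t x * ψxx t x) t x =
          χ t x * y t x * (ψt t x + a x * ψx t x +
            (derivWithin a (Icc 0 L) x - b x) * ψ t x) +
          ε * (y t x * (χxx t x * ψ t x + 2 * (χx t x * ψx t x) + χ t x * ψxx t x)) := by
        simp only [adjointExpr]
        linear_combination (y t x * ψ t x) * htr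
      rw [hsplit, Real.norm_eq_abs]
      refine (abs_add_le _ _).trans (add_le_add ?_ ?_)
      · rw [abs_mul, abs_mul]
        by_cases h0 : χ t x = 0
        · simp [h0]
        · exact mul_le_mul_of_nonneg_left (hres t ht x h0) (by positivity)
      · rw [abs_mul, abs_of_pos hε, abs_mul]
        gcongr
  have hall : |∫ t in Ioo 0 T, ∫ x in Ioo 0 L, y t x * adjointExpr a b L ε
      (fun t x => χ t x * ψ t x) (fun t x => χt t x * ψ t x + χ t x * ψt t x)
      (fun t x => χx t x * ψ t x + χ t x * ψx t x)
      (fun t x => χxx t x * ψ t x + 2 * (χx t x * ψx t x) + χ t x * ψxx t x) t x| ≤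
      T * (V * (m / (4 * (T * V + 1)))) + Q * (√ε / 2 * (T + Kg * (1 + R ^ 2))) := by
    have hbi : Continuous fun t => V * (m / (4 * (T * V + 1))) +
        Q * (√ε / 2 * (1 + ε * ‖y t‖ ^ 2)) := by fun_prop
    have hle := norm_integral_le_of_norm_le (f := fun t => ∫ x in Ioo 0 L,
      y t x * adjointExpr a b L ε
      (fun t x => χ t x * ψ t x) (fun t x => χt t x * ψ t x + χ t x * ψt t x)
      (fun t x => χx t x * ψ t x + χ t x * ψx t x)
      (fun t x => χxx t x * ψ t x + 2 * (χx t x * ψx t x) + χ t x * ψxx t x) t x)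
      (μ := volume.restrict (Ioo 0 T))
      ((hbi.continuousOn (s := Icc 0 T)).integrableOn_Icc.mono_set Ioo_subset_Icc_self) ?_
    · rw [integral_Ioo_eq_intervalIntegral hT, Real.norm_eq_abs, integral_Ioo_eq_intervalIntegral hT,
        intervalIntegral.integral_add (Continuous.intervalIntegrable (by fun_prop) _ _)
          (Continuous.intervalIntegrable (by fun_prop) _ _),
        intervalIntegral.integral_const_mul Q, intervalIntegral.integral_const_mul (√ε / 2),
        intervalIntegral.integral_add (Continuous.intervalIntegrable (by fun_prop) _ _)
          (Continuous.intervalIntegrable (by fun_prop) _ _),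
        intervalIntegral.integral_const_mul ε, intervalIntegral.integral_const,
        intervalIntegral.integral_const, sub_zero, smul_eq_mul, smul_eq_mul, mul_one] at hle
      rw [integral_Ioo_eq_intervalIntegral hT]
      refine hle.trans (add_le_add le_rfl ?_)
      refine mul_le_mul_of_nonneg_left (mul_le_mul_of_nonneg_left ?_ (by positivity))
        (norm_nonneg _)
      linarith
    · filter_upwards [ae_restrict_mem measurableSet_Ioo] with t ht
      refine (hslice t (Ioo_subset_Icc_self ht)).trans (add_le_add le_rfl ?_)
      refine mul_le_mul_of_nonneg_left ?_ (norm_nonneg _)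
      have hs : √ε * √ε = ε := Real.mul_self_sqrt hε.le
      have hs0 := Real.sqrt_nonneg ε
      -- Young's inequality in the form ε‖y‖ ≤ (√ε/2)(1 + ε‖y‖²): the bounded quantity ε∫‖y‖² then
      -- yields a contribution of size √ε.
      have h1 : √ε / 2 * (1 + ε * ‖y t‖ ^ 2) - ε * ‖y t‖ = √ε / 2 * (1 - √ε * ‖y t‖) ^ 2 := by
        linear_combination (‖y t‖ - √ε / 2 * ‖y t‖ ^ 2) * hs
      have h2 : 0 ≤ √ε / 2 * (1 - √ε * ‖y t‖) ^ 2 := by positivity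
      linarith
  have hδb : T * (V * (m / (4 * (T * V + 1)))) ≤ m / 4 := by
    have hTV : 0 ≤ T * V := by positivity
    rw [← mul_assoc, ← mul_div_assoc, div_le_div_iff₀ (by positivity) (by positivity)]
    nlinarith
  rw [hbd, hend] at key
  -- The identity would give m ≤ T V δ + O(√ε) < m/4 + m/4, impossible since m > 0.
  have hfin := neg_le_abs (∫ t in Ioo 0 T, ∫ x in Ioo 0 L, y t x * adjointExpr a b L ε
      (fun t x => χ t x * ψ t x) (fun t x => χt t x * ψ t x + χ t x * ψt t x)
      (fun t x => χx t x * ψ t x + χ t x * ψx t x)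
      (fun t x => χxx t x * ψ t x + 2 * (χx t x * ψx t x) + χ t x * ψxx t x) t x)
  linarith

end Cost

end ViscousTransport

end

/-! ### Conclusion -/

theorem propositionp (L T : ℝ) (hL : 0 < L) (hT : 0 < T) (a b : ℝ → ℝ)
    (ha : ContDiffOn ℝ 1 a (Set.Icc 0 L))
    (hb : MemLp b ⊤ (volume.restrict (Set.Ioo 0 L)))
    (hTa : ENNReal.ofReal T < ViscousTransport.transportTime a L) :
    Filter.liminf (fun ε : ℝ => ViscousTransport.controlCost a b L T ε) (𝓝[>] (0 : ℝ)) = ⊤ := by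
  obtain ⟨p, q, χ, χt, χx, χxx, hχ⟩ := ViscousTransport.exists_cutoff hL hT.le ha hb hTa
  have hX := hχ.norm_pos
  -- The same normalised datum χ(0)/‖χ(0)‖ works for every level R; only the threshold on ε depends
  -- on R. If there is no null control the infimum is +∞, and the bound holds vacuously.
  refine ENNReal.eq_top_of_forall_nnreal_le fun R => le_liminf_of_le (by isBoundedDefault) ?_
  filter_upwards [hχ.eventually_le_norm hL hT.le ha hb (R := R)] with ε hε
  refine le_iSup₂_of_le (‖ViscousTransport.toL2 L (χ 0)‖⁻¹ • ViscousTransport.toL2 L (χ 0)) ?_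
    (le_iInf₂ fun h hh => ?_)
  · rw [norm_smul, norm_inv, norm_norm, inv_mul_cancel₀ hX.ne']
  · rw [← ENNReal.ofReal_coe_nnreal]
    exact ENNReal.ofReal_le_ofReal (hε h hh)
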